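/- For each sample size $n$ consider the regression $Y=X\beta+\varepsilon$ with $Y,\varepsilon\in\mathbb R^n$ random, $X\in\mathbb R^{n\times p}$ random, $\beta\in\mathbb R^p$ nonrandom and $p=p_n$. Let $J=J_n\subset\{1,\dots,p\}$ be a nonrandom set of size $m=m_n$. All objects may depend on $n$, except the number $r$ of factors and the constants, which do not. For vectors $\|\cdot\|$ is the Euclidean norm and for matrices the Frobenius norm; $A_J$ denotes the columns of $A$ with index in $J$ and $v_J$ the entries of $v$ with index in $J$. Assume that $\sup_{n,t}E\varepsilon_t^2<\infty$ and that, for some constant $M$: A1. $x_{tj}=\lambda_j^Tf_t+e_{tj}$, i.e. $X=F\Lambda^T+E$, with random factors $f_t\in\mathbb R^r$, nonrandom loadings $\lambda_j\in\mathbb R^r$ and random $e_{tj}$. A2. $n=O(p)$ and $m^2/n\to0$ as $n\to\infty$. A3. $\sum_{j=1}^p|\beta_j|\le M$. B1. $E\|f_t\|^4<\infty$, and $\frac1nF^TF\to\Sigma_F$ in probability for some positive definite $\Sigma_F$. B2. $\|\lambda_j\|\le\bar\lambda<\infty$, and $\|\frac1p\Lambda^T\Lambda-\Sigma_\Lambda\|\to0$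 for some positive definite $\Sigma_\Lambda$. B3. (1) $E e_{ti}=0$ and $E|e_{ti}|^8\le M$. (2) With $\gamma(s,t)=E\big(\frac1p\sum_ie_{si}e_{ti}\big)$, $|\gamma(s,s)|\le M$ for all $s$ and $\frac1n\sum_{s,t}|\gamma(s,t)|\le M$. (3) There are $\tau_{ij}$ with $|E(e_{ti}e_{tj})|\le|\tau_{ij}|$ for all $t$ and $\frac1p\sum_{i,j}|\tau_{ij}|\le M$. (4) $\frac1{np}\sum_{i,j}\sum_{t,s}|E(e_{ti}e_{sj})|\le M$. (5) $E\big|p^{-1/2}\sum_i[e_{si}e_{ti}-E(e_{si}e_{ti})]\big|^4\le M$ for all $s,t$. B4. $E\big(\frac1p\sum_{i=1}^p\|\frac1{\sqrt n}\sum_tf_te_{ti}\|^2\big)\le M$. C1. $\|\frac1nE_J^TE_J-G_J\|\to0$ in probability for some symmetric matrices $G_J$ whose smallest eigenvalues are at least some $c>0$ not depending on $n$. C2. $E\big(\frac1m\sum_{j\in J}\|\frac1{\sqrt n}\sum_tf_te_{tj}\|^2\big)\le M$. C3. $E\big(\frac1m\sum_{j\in J}(\frac1{\sqrt n}\sum_t\varepsilon_te_{tj})^2\big)\le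 M$. C4. $E\big(\frac1m\sum_{j\in J}(\frac1{\sqrt n}\sum_te_{ti}e_{tj})^2\big)\le M$ for every $i\notin J$. For each $k$ let $\bar\Lambda^k$ be $\sqrt p$ times orthonormal eigenvectors for the $k$ largest eigenvalues of $X^TX$ (the first $k$ vectors of an arbitrarily chosen orthonormal eigenbasis ordered by decreasing eigenvalue), $\bar F^k=X\bar\Lambda^k/p$ and $\hat F^k=\bar F^k\big((\bar F^k)^T\bar F^k/n\big)^{1/2}$. Put $V(k)=\min_L\|X-\hat F^kL^T\|^2$, and let $\hat k$ be a minimizer of $\mathrm{IC}(k)=\log V(k)+k\,\frac{n+p}{np}\log\frac{np}{n+p}$ over $1\le k\le k_{\max}$. With $k$ estimated factors put $\tilde X_J=\big(I-\hat F^k((\hat F^k)^T\hat F^k)^{-1}(\hat F^k)^T\big)X_J$ and $$\tilde\beta_J^{0}=(\tilde X_J^T\tilde X_J)^{-1}\tilde X_J^TY.$$ Then, with $k=r$ estimated factors, $$\|\tilde\beta_J^0-\beta_J\|=O_p\big(\sqrt{m/n}\big)\qquad(n\to\infty),$$ and in particular $\|\tilde\beta_J^0-\beta_J\|\to0$ in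 probability. Moreover, for the estimator with $k=\hat k$ the same rate holds given $\hat k=r$: for all $\eta,\delta>0$ there is $C$ such that for all large $n$ with $P(\hat k=r)\ge\delta$, $P\big(\|\tilde\beta_J^0-\beta_J\|>C\sqrt{m/n}\,\big|\,\hat k=r\big)\le\eta$. -/

import Mathlib

open MeasureTheory Filter Topology Matrix

noncomputable section

namespace FactorReg

/-- The Frobenius norm `‖A‖ = (∑ᵢ ∑ⱼ Aᵢⱼ²)^{1/2}`. -/
def frobNorm {ι κ : Type*} [Fintype ι] [Fintype κ] (A : Matrix ι κ ℝ) : ℝ :=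
  Real.sqrt (∑ i, ∑ j, A i j ^ 2)

/-- The Euclidean norm of a real vector. -/
def vecNorm {ι : Type*} [Fintype ι] (v : ι → ℝ) : ℝ := ‖WithLp.toLp 2 v‖

/-- The expectation of `Z` exists and is at most `M`. -/
def ExpLe {Ω : Type*} [MeasurableSpace Ω] (μ : Measure Ω) (Z : Ω → ℝ) (M : ℝ) : Prop :=
  Integrable Z μ ∧ ∫ ω, Z ω ∂μ ≤ M

/-- `Z n = O_p(a n)` as `n → ∞`. -/
def IsBigOp {Ω : Type*} [MeasurableSpace Ω] (μ : Measure Ω) (Z : ℕ → Ω → ℝ) (a : ℕ → ℝ) : Prop :=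
  ∀ η : ℝ, 0 < η → ∃ C : ℝ, ∀ᶠ n in atTop, μ {ω | C * a n < |Z n ω|} ≤ ENNReal.ofReal η

/-! ### Estimation of the factors -/

section Factors

variable {n p : ℕ}

/-- The columns of `W` are an orthonormal basis of eigenvectors of `A`, ordered so that the
eigenvalues are decreasing. -/
def IsSortedEigenbasis (A W : Matrix (Fin p) (Fin p) ℝ) : Prop :=
  Wᵀ * W = 1 ∧ ∃ d : Fin p → ℝ, Antitone d ∧ A * W = W * diagonal d

/-- `√p` times the first `k` columns of `W`. -/
def loadBar (W : Matrix (Fin p) (Fin p) ℝ) (k : ℕ) :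
    Matrix (Fin p) {i : Fin p // (i : ℕ) < k} ℝ :=
  Real.sqrt p • W.submatrix id Subtype.val

/-- The factors `F̄ᵏ = X Λ̄ᵏ / p`. -/
def facBar (X : Matrix (Fin n) (Fin p) ℝ) (W : Matrix (Fin p) (Fin p) ℝ) (k : ℕ) :
    Matrix (Fin n) {i : Fin p // (i : ℕ) < k} ℝ :=
  (p : ℝ)⁻¹ • (X * loadBar W k)

/-- The rescaled factors `F̂ᵏ = F̄ᵏ ((F̄ᵏ)ᵀ F̄ᵏ / n)^{1/2}`. -/
def facHat (X : Matrix (Fin n) (Fin p) ℝ) (W : Matrix (Fin p) (Fin p) ℝ) (k : ℕ) :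
    Matrix (Fin n) {i : Fin p // (i : ℕ) < k} ℝ :=
  facBar X W k * cfc Real.sqrt ((n : ℝ)⁻¹ • ((facBar X W k)ᵀ * facBar X W k))

/-- `V(k) = min_L ‖X - F̂ᵏ Lᵀ‖²`. -/
def fitError (X : Matrix (Fin n) (Fin p) ℝ) (W : Matrix (Fin p) (Fin p) ℝ) (k : ℕ) : ℝ :=
  ⨅ L : Matrix (Fin p) {i : Fin p // (i : ℕ) < k} ℝ, frobNorm (X - facHat X W k * Lᵀ) ^ 2

/-- `IC(k) = log V(k) + k ((n + p) / (n p)) log (n p / (n + p))`, with `log 0 = -∞`. -/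
def infoCrit (X : Matrix (Fin n) (Fin p) ℝ) (W : Matrix (Fin p) (Fin p) ℝ) (k : ℕ) : EReal :=
  ENNReal.log (ENNReal.ofReal (fitError X W k)) +
    (((k : ℝ) * (((n : ℝ) + p) / ((n : ℝ) * p)) *
      Real.log (((n : ℝ) * p) / ((n : ℝ) + p)) : ℝ) : EReal)

/-- `k` minimizes the information criterion over `{1, …, kmax}`. -/
def IsFactorNumber (X : Matrix (Fin n) (Fin p) ℝ) (W : Matrix (Fin p) (Fin p) ℝ)
    (kmax k : ℕ) : Prop :=
  k ∈ Finset.Icc 1 kmax ∧ ∀ l ∈ Finset.Icc 1 kmax, infoCrit X W k ≤ infoCrit X W l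

/-! ### Estimation of the coefficients -/

/-- The submatrix of the columns with index in `J`. -/
def cols (X : Matrix (Fin n) (Fin p) ℝ) (J : Finset (Fin p)) : Matrix (Fin n) J ℝ :=
  X.submatrix id Subtype.val

/-- `X̃_J = (I - F̂ (F̂ᵀ F̂)⁻¹ F̂ᵀ) X_J` with `k` estimated factors `F̂ = F̂ᵏ`. -/
def xTilde (X : Matrix (Fin n) (Fin p) ℝ) (W : Matrix (Fin p) (Fin p) ℝ) (k : ℕ)
    (J : Finset (Fin p)) : Matrix (Fin n) J ℝ :=
  (1 - facHat X W k * ((facHat X W k)ᵀ * facHat X W k)⁻¹ * (facHat X W k)ᵀ) * cols X J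

/-- `β̃⁰_J = (X̃_Jᵀ X̃_J)⁻¹ X̃_Jᵀ Y` with `k` estimated factors. -/
def betaTilde (X : Matrix (Fin n) (Fin p) ℝ) (W : Matrix (Fin p) (Fin p) ℝ) (k : ℕ)
    (J : Finset (Fin p)) (Y : Fin n → ℝ) : J → ℝ :=
  ((xTilde X W k J)ᵀ * xTilde X W k J)⁻¹ *ᵥ ((xTilde X W k J)ᵀ *ᵥ Y)

end Factors

/-! ### The model -/

/-- The data of a linear regression with `p n` predictors and `r` common factors, for every
sample size `n`: factors `F` (rows `f_t`), loadings `Λ` (rows `λ_j`), idiosyncratic components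
`e` (entries `e_{tj}`), regression errors `ε`, coefficients `β`, and a nonrandom selection
set `J`. -/
structure Model (Ω : Type*) where
  r : ℕ
  p : ℕ → ℕ
  F : ∀ n, Ω → Matrix (Fin n) (Fin r) ℝ
  Λ : ∀ n, Matrix (Fin (p n)) (Fin r) ℝ
  e : ∀ n, Ω → Matrix (Fin n) (Fin (p n)) ℝ
  ε : ∀ n, Ω → Fin n → ℝ
  β : ∀ n, Fin (p n) → ℝ
  J : ∀ n, Finset (Fin (p n))

namespace Model

variable {Ω : Type*}

/-- The size of the selection set. -/
def m (S : Model Ω) (n : ℕ) : ℕ := (S.J n).card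

/-- The predictors `x_{tj} = λ_jᵀ f_t + e_{tj}`, that is `X = F Λᵀ + E`. -/
def X (S : Model Ω) (n : ℕ) (ω : Ω) : Matrix (Fin n) (Fin (S.p n)) ℝ :=
  S.F n ω * (S.Λ n)ᵀ + S.e n ω

/-- The responses `Y = X β + ε`. -/
def Y (S : Model Ω) (n : ℕ) (ω : Ω) : Fin n → ℝ := S.X n ω *ᵥ S.β n + S.ε n ω

/-- The coefficients in the selection set. -/
def βJ (S : Model Ω) (n : ℕ) : S.J n → ℝ := fun j => S.β n j

/-- The error `‖β̃⁰_J - β_J‖` of the estimator with `k` estimated factors. -/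
def estError (S : Model Ω) (W : ∀ n, Ω → Matrix (Fin (S.p n)) (Fin (S.p n)) ℝ) (k n : ℕ)
    (ω : Ω) : ℝ :=
  vecNorm (betaTilde (S.X n ω) (W n ω) k (S.J n) (S.Y n ω) - S.βJ n)

variable [MeasurableSpace Ω]

/-- All random quantities are random variables, and the regression errors have uniformly bounded
second moments. -/
structure Regular (S : Model Ω) (μ : Measure Ω) : Prop where
  meas_F : ∀ n t a, Measurable fun ω => S.F n ω t a
  meas_e : ∀ n t j, Measurable fun ω => S.e n ω t j
  meas_ε : ∀ n t, Measurable fun ω => S.ε n ω t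
  var_ε : ∃ K : ℝ, ∀ n t, ExpLe μ (fun ω => S.ε n ω t ^ 2) K

/-- Model design (that `X = F Λᵀ + E` is part of the definition of `X`). -/
structure AssumptionA (S : Model Ω) (M : ℝ) : Prop where
  A2_p : (fun n : ℕ => (n : ℝ)) =O[atTop] (fun n => (S.p n : ℝ))
  A2_m : Tendsto (fun n : ℕ => (S.m n : ℝ) ^ 2 / n) atTop (𝓝 0)
  A3 : ∀ n, ∑ j, |S.β n j| ≤ M

/-- Factors, loadings and idiosyncratic components. -/
structure AssumptionB (S : Model Ω) (μ : Measure Ω) (M : ℝ) : Prop where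
  B1_moment : ∀ n t, Integrable (fun ω => vecNorm (S.F n ω t) ^ 4) μ
  B1_limit : ∃ SF : Matrix (Fin S.r) (Fin S.r) ℝ, SF.PosDef ∧
    TendstoInMeasure μ
      (fun (n : ℕ) ω => frobNorm ((n : ℝ)⁻¹ • ((S.F n ω)ᵀ * S.F n ω) - SF)) atTop (fun _ => 0)
  B2_bound : ∃ K : ℝ, ∀ n i, vecNorm (S.Λ n i) ≤ K
  B2_limit : ∃ SL : Matrix (Fin S.r) (Fin S.r) ℝ, SL.PosDef ∧
    Tendsto (fun n => frobNorm ((S.p n : ℝ)⁻¹ • ((S.Λ n)ᵀ * S.Λ n) - SL)) atTop (𝓝 0)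
  B3_moment : ∀ n t i, ExpLe μ (fun ω => |S.e n ω t i| ^ 8) M
  B3_mean : ∀ n t i, ∫ ω, S.e n ω t i ∂μ = 0
  B3_serial_diag : ∀ n s, |∫ ω, (S.p n : ℝ)⁻¹ * ∑ i, S.e n ω s i * S.e n ω s i ∂μ| ≤ M
  B3_serial : ∀ n : ℕ, (n : ℝ)⁻¹ * ∑ s, ∑ t,
    |∫ ω, (S.p n : ℝ)⁻¹ * ∑ i, S.e n ω s i * S.e n ω t i ∂μ| ≤ M
  B3_cross : ∀ n, ∃ τ : Matrix (Fin (S.p n)) (Fin (S.p n)) ℝ,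
    (∀ i j t, |∫ ω, S.e n ω t i * S.e n ω t j ∂μ| ≤ |τ i j|) ∧
      (S.p n : ℝ)⁻¹ * ∑ i, ∑ j, |τ i j| ≤ M
  B3_joint : ∀ n : ℕ, ((n : ℝ) * S.p n)⁻¹ *
    ∑ i, ∑ j, ∑ t, ∑ s, |∫ ω, S.e n ω t i * S.e n ω s j ∂μ| ≤ M
  B3_fourth : ∀ n s t, ExpLe μ
    (fun ω => |(Real.sqrt (S.p n))⁻¹ *
      ∑ i, (S.e n ω s i * S.e n ω t i - ∫ ω', S.e n ω' s i * S.e n ω' t i ∂μ)| ^ 4) M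
  B4 : ∀ n : ℕ, ExpLe μ
    (fun ω => (S.p n : ℝ)⁻¹ *
      ∑ i, vecNorm ((Real.sqrt n)⁻¹ • ∑ t, S.e n ω t i • S.F n ω t) ^ 2) M

/-- The selection set. -/
structure AssumptionC (S : Model Ω) (μ : Measure Ω) (M : ℝ) : Prop where
  C1 : ∃ G : ∀ n, Matrix (S.J n) (S.J n) ℝ,
    (∃ c : ℝ, 0 < c ∧ ∀ n, (G n - c • (1 : Matrix (S.J n) (S.J n) ℝ)).PosSemidef) ∧
    TendstoInMeasure μ
      (fun (n : ℕ) ω => frobNorm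
        ((n : ℝ)⁻¹ • ((cols (S.e n ω) (S.J n))ᵀ * cols (S.e n ω) (S.J n)) - G n))
      atTop (fun _ => 0)
  C2 : ∀ n : ℕ, ExpLe μ
    (fun ω => (S.m n : ℝ)⁻¹ *
      ∑ j ∈ S.J n, vecNorm ((Real.sqrt n)⁻¹ • ∑ t, S.e n ω t j • S.F n ω t) ^ 2) M
  C3 : ∀ n : ℕ, ExpLe μ
    (fun ω => (S.m n : ℝ)⁻¹ *
      ∑ j ∈ S.J n, ((Real.sqrt n)⁻¹ * ∑ t, S.ε n ω t * S.e n ω t j) ^ 2) M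
  C4 : ∀ n : ℕ, ∀ i ∉ S.J n, ExpLe μ
    (fun ω => (S.m n : ℝ)⁻¹ *
      ∑ j ∈ S.J n, ((Real.sqrt n)⁻¹ * ∑ t, S.e n ω t i * S.e n ω t j) ^ 2) M

end Model

end FactorReg

end

/-! Write `P` for the projection onto the span of the estimated factors and `P_F` for the projection
onto the columns of `F`. Splitting off the unselected predictors gives `Y = X_J β_J + F q + w` with
`q = Λᵀ β_C` bounded and `w = E β_C + ε` of norm `O(√n)`. With `T = (1 - P) X_J`, the error of the
estimator solves `TᵀT b = Tᵀ(F q + w)`. It therefore suffices that `T` is bounded below by a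
multiple of `√n` and that the right side is `O(√(mn))`.

Both facts rest on `‖(1 - P_F) P‖ = O(1/√n)` (`FactorBounds.exists_orthProj`). The range of `P` is
spanned by left singular vectors `U` of `X`, so `U = XXᵀ U D⁻¹`, where the `r` leading eigenvalues
in `D` have order at least `np` by a minimax argument (`le_eigenvalue`). Since `1 - P_F` kills the
factor part of `X`, only `E Xᵀ` remains, and its norm is `O(p√n)`. The two projections have the same
rank `r`, so the defect is symmetric: `(1 - P) P_F` is equally small, whence `(1 - P) F = O(1)`.
Similarly `P E_J = O(√m)`. Thus `T` differs from `E_J` by `O(√m)`, which is negligible against the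
lower bound `√n` for `E_J`.

All of this is deterministic once finitely many norms are bounded by a common constant times their
order (`FactorBounds`, `FactorBounds.vecNorm_betaTilde_sub_le`). Markov's inequality and the assumed
limits supply these bounds with probability close to one. The conditional rate follows because an
event of probability at most `ηδ` has conditional probability at most `η` given an event of
probability at least `δ`. -/

namespace Matrix

/-- The Gram matrix of the unscaled estimated factors turns out to be diagonal, so this evaluates
the matrix square root in `facHat`. -/
lemma cfc_sqrt_diagonal_sq {ι : Type*} [Fintype ι] [DecidableEq ι] (s : ι → ℝ)
    (hs : ∀ i, 0 ≤ s i) : cfc Real.sqrt (diagonal fun i => s i ^ 2) = diagonal s := by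
  have ha : IsSelfAdjoint (diagonal s) := isHermitian_diagonal s
  have h1 : (diagonal fun i => s i ^ 2) = cfc (fun x : ℝ => x ^ 2) (diagonal s) := by
    rw [cfc_pow_id (R := ℝ) (diagonal s) 2 ha, diagonal_pow]
    rfl
  rw [h1, ← cfc_comp' Real.sqrt (fun x : ℝ => x ^ 2) (diagonal s)]
  conv_rhs => rw [← cfc_id' ℝ (diagonal s)]
  refine cfc_congr fun x hx => ?_
  rw [spectrum_diagonal] at hx
  obtain ⟨i, rfl⟩ := hx
  exact Real.sqrt_sq (hs i)

end Matrix

/-! ### Frobenius norm and orthogonal projections -/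

section FrobeniusNorm

open scoped Matrix.Norms.Frobenius

variable {ι κ ν : Type*} [Fintype ι] [Fintype κ] [Fintype ν]

lemma frobenius_norm_sq (A : Matrix ι κ ℝ) : ‖A‖ ^ 2 = ∑ i, ∑ j, A i j ^ 2 := by
  rw [frobenius_norm_def, ← Real.sqrt_eq_rpow, Real.sq_sqrt (by positivity)]
  simp

lemma FactorReg.frobNorm_eq (A : Matrix ι κ ℝ) : FactorReg.frobNorm A = ‖A‖ := by
  rw [FactorReg.frobNorm, ← frobenius_norm_sq, Real.sqrt_sq (norm_nonneg _)]

lemma FactorReg.vecNorm_eq (v : ι → ℝ) : FactorReg.vecNorm v = ‖replicateCol Unit v‖ := by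
  rw [frobenius_norm_replicateCol]; rfl

lemma frobenius_norm_sq_eq_trace (A : Matrix ι κ ℝ) : ‖A‖ ^ 2 = (Aᵀ * A).trace := by
  rw [frobenius_norm_sq, Finset.sum_comm]
  simp [trace, mul_apply, sq]

lemma abs_trace_transpose_mul_le (A B : Matrix ι κ ℝ) : |(Aᵀ * B).trace| ≤ ‖A‖ * ‖B‖ := by
  have h : (Aᵀ * B).trace = ∑ x : κ × ι, A x.2 x.1 * B x.2 x.1 := by
    simp [trace, mul_apply, Fintype.sum_prod_type]
  have hA (C : Matrix ι κ ℝ) : ∑ x : κ × ι, C x.2 x.1 ^ 2 = ‖C‖ ^ 2 := by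
    rw [frobenius_norm_sq, Finset.sum_comm, Fintype.sum_prod_type]
  have := Finset.sum_mul_sq_le_sq_mul_sq Finset.univ
    (fun x : κ × ι => A x.2 x.1) (fun x => B x.2 x.1)
  rw [h]
  refine abs_le_of_sq_le_sq ?_ (by positivity)
  rw [mul_pow, ← hA A, ← hA B]
  exact this

lemma frobenius_norm_one_sq [DecidableEq ι] : ‖(1 : Matrix ι ι ℝ)‖ ^ 2 = Fintype.card ι := by
  rw [frobenius_norm_sq_eq_trace]; simp

/-- Multiplication by a matrix with orthonormal columns preserves the Frobenius norm. -/
lemma frobenius_norm_isometry_mul [DecidableEq κ] {U : Matrix ι κ ℝ} (hU : Uᵀ * U = 1)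
    (A : Matrix κ ν ℝ) : ‖U * A‖ = ‖A‖ := by
  refine (sq_eq_sq₀ (norm_nonneg _) (norm_nonneg _)).1 ?_
  rw [frobenius_norm_sq_eq_trace, frobenius_norm_sq_eq_trace, transpose_mul, Matrix.mul_assoc,
    ← Matrix.mul_assoc Uᵀ, hU, Matrix.one_mul]

/-- A symmetric idempotent matrix. -/
structure IsOrthProj (Q : Matrix ι ι ℝ) : Prop where
  symm : Qᵀ = Q
  idem : Q * Q = Q

namespace IsOrthProj

variable {Q R : Matrix ι ι ℝ}

lemma one_sub [DecidableEq ι] (hQ : IsOrthProj Q) : IsOrthProj (1 - Q) where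
  symm := by rw [transpose_sub, transpose_one, hQ.symm]
  idem := by
    rw [Matrix.mul_sub, Matrix.sub_mul, Matrix.sub_mul, hQ.idem]
    simp

lemma norm_mul_sq (hQ : IsOrthProj Q) (A : Matrix ι κ ℝ) :
    ‖Q * A‖ ^ 2 = (Aᵀ * (Q * A)).trace := by
  rw [frobenius_norm_sq_eq_trace, transpose_mul, hQ.symm, Matrix.mul_assoc, ← Matrix.mul_assoc Q,
    hQ.idem]

lemma norm_mul_le (hQ : IsOrthProj Q) (A : Matrix ι κ ℝ) : ‖Q * A‖ ≤ ‖A‖ := by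
  have h := (le_abs_self _).trans (abs_trace_transpose_mul_le A (Q * A))
  rw [← hQ.norm_mul_sq] at h
  nlinarith [norm_nonneg A, norm_nonneg (Q * A)]

lemma norm_mul_sq' (hQ : IsOrthProj Q) (hR : IsOrthProj R) :
    ‖Q * R‖ ^ 2 = (Q * R).trace := by
  rw [hQ.norm_mul_sq, hR.symm, ← Matrix.mul_assoc, trace_mul_comm, ← Matrix.mul_assoc, hR.idem,
    trace_mul_comm]

/-- For two orthogonal projections of equal rank, the two defects of inclusion agree. -/
lemma norm_one_sub_mul_comm [DecidableEq ι] (hQ : IsOrthProj Q) (hR : IsOrthProj R)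
    (h : Q.trace = R.trace) : ‖(1 - Q) * R‖ = ‖(1 - R) * Q‖ := by
  -- The squared defects are `tr R - tr QR` and `tr Q - tr RQ`.
  refine (sq_eq_sq₀ (norm_nonneg _) (norm_nonneg _)).1 ?_
  rw [hQ.one_sub.norm_mul_sq' hR, hR.one_sub.norm_mul_sq' hQ, Matrix.sub_mul, Matrix.sub_mul,
    trace_sub, trace_sub, trace_mul_comm Q R, Matrix.one_mul, Matrix.one_mul, h]

end IsOrthProj

lemma isOrthProj_mul_transpose [DecidableEq κ] {U : Matrix ι κ ℝ} (hU : Uᵀ * U = 1) :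
    IsOrthProj (U * Uᵀ) where
  symm := by simp
  idem := by rw [Matrix.mul_assoc, ← Matrix.mul_assoc Uᵀ, hU, Matrix.one_mul]

/-- The orthogonal projection onto the column space of a matrix with full column rank. -/
noncomputable def colProj [DecidableEq κ] (A : Matrix ι κ ℝ) : Matrix ι ι ℝ := A * (Aᵀ * A)⁻¹ * Aᵀ

section ColProj

variable [DecidableEq κ] {A : Matrix ι κ ℝ}

lemma colProj_mul_self (hA : IsUnit (Aᵀ * A).det) : colProj A * A = A := by
  rw [colProj, Matrix.mul_assoc, Matrix.mul_assoc, Matrix.nonsing_inv_mul _ hA, Matrix.mul_one]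

lemma isOrthProj_colProj (hA : IsUnit (Aᵀ * A).det) : IsOrthProj (colProj A) where
  symm := by
    rw [colProj, transpose_mul, transpose_mul, transpose_transpose, transpose_nonsing_inv,
      transpose_mul, transpose_transpose, Matrix.mul_assoc]
  idem := by
    nth_rewrite 2 [colProj]
    rw [← Matrix.mul_assoc, ← Matrix.mul_assoc, colProj_mul_self hA, colProj]

lemma trace_colProj (hA : IsUnit (Aᵀ * A).det) : (colProj A).trace = Fintype.card κ := by
  rw [colProj, trace_mul_comm, ← Matrix.mul_assoc, Matrix.mul_nonsing_inv _ hA, trace_one]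

/-- Nonzero rescaling of the columns does not change their span; hence the normalization of the
estimated factors has no effect on the regression. -/
lemma colProj_mul_diagonal {U : Matrix ι κ ℝ} (hU : Uᵀ * U = 1) {s : κ → ℝ}
    (hs : ∀ i, s i ≠ 0) : colProj (U * diagonal s) = U * Uᵀ := by
  have h1 : (U * diagonal s)ᵀ * (U * diagonal s) = diagonal s * diagonal s := by
    rw [transpose_mul, diagonal_transpose, Matrix.mul_assoc, ← Matrix.mul_assoc Uᵀ, hU,
      Matrix.one_mul]
  have h2 : diagonal s * diagonal (fun i => (s i)⁻¹) = 1 := by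
    rw [diagonal_mul_diagonal, ← diagonal_one]
    congr 1; ext i; exact mul_inv_cancel₀ (hs i)
  have h3 : diagonal (fun i => (s i)⁻¹) * diagonal s = 1 := by
    rw [diagonal_mul_diagonal, ← diagonal_one]
    congr 1; ext i; exact inv_mul_cancel₀ (hs i)
  rw [colProj, h1, Matrix.mul_inv_rev, Matrix.inv_eq_right_inv h2, transpose_mul,
    diagonal_transpose]
  calc U * diagonal s * (diagonal (fun i => (s i)⁻¹) * diagonal (fun i => (s i)⁻¹)) *
        (diagonal s * Uᵀ)
      = U * (diagonal s * diagonal (fun i => (s i)⁻¹)) *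
        (diagonal (fun i => (s i)⁻¹) * diagonal s) * Uᵀ := by simp only [Matrix.mul_assoc]
    _ = U * Uᵀ := by rw [h2, h3, Matrix.mul_one, Matrix.mul_one]

end ColProj

lemma norm_le_of_gram_inv [DecidableEq κ] {G : Matrix κ κ ℝ} (hG : IsUnit G.det)
    (A : Matrix κ ν ℝ) : ‖A‖ ≤ ‖G⁻¹‖ * ‖G * A‖ := by
  calc ‖A‖ = ‖G⁻¹ * (G * A)‖ := by
        rw [← Matrix.mul_assoc, Matrix.nonsing_inv_mul _ hG, Matrix.one_mul]
    _ ≤ _ := frobenius_norm_mul _ _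

end FrobeniusNorm

/-! ### Least squares with a coercive design -/

section NormalEquation

open scoped Matrix.Norms.Frobenius

variable {ι κ : Type*} [Fintype ι] [Fintype κ] {A : Matrix ι κ ℝ} {s : ℝ}

lemma isUnit_det_gram [DecidableEq κ] (hs : 0 < s) (hA : ∀ a : Matrix κ Unit ℝ, s * ‖a‖ ≤ ‖A * a‖) :
    IsUnit (Aᵀ * A).det := by
  rw [isUnit_iff_ne_zero]
  intro h0
  obtain ⟨v, hv, hv0⟩ := exists_mulVec_eq_zero_iff.2 h0
  have h1 : Aᵀ * A * replicateCol Unit v = 0 := by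
    rw [← replicateCol_mulVec, hv0]; rfl
  have h2 : ‖A * replicateCol Unit v‖ ^ 2 = 0 := by
    rw [frobenius_norm_sq_eq_trace, transpose_mul, Matrix.mul_assoc, ← Matrix.mul_assoc Aᵀ, h1]
    simp
  have h3 := hA (replicateCol Unit v)
  rw [pow_eq_zero_iff two_ne_zero] at h2
  rw [h2] at h3
  have h4 : ‖replicateCol Unit v‖ = 0 := by
    nlinarith [norm_nonneg (replicateCol Unit v)]
  rw [norm_eq_zero] at h4
  exact hv (funext fun i => congrFun (congrFun h4 i) ())

/-- A bound for the solution of the normal equations. -/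
lemma norm_le_of_normal_equation (hs : 0 < s)
    (hA : ∀ a : Matrix κ Unit ℝ, s * ‖a‖ ≤ ‖A * a‖) {b : Matrix κ Unit ℝ} {y : Matrix κ Unit ℝ}
    (h : Aᵀ * A * b = y) : ‖b‖ ≤ ‖y‖ / s ^ 2 := by
  -- Pair the normal equations with `b`; coercivity bounds the left side below by `s² ‖b‖²`.
  have h1 : ‖A * b‖ ^ 2 ≤ ‖b‖ * ‖y‖ := by
    rw [frobenius_norm_sq_eq_trace, transpose_mul, Matrix.mul_assoc, ← Matrix.mul_assoc Aᵀ, h]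
    exact (le_abs_self _).trans (abs_trace_transpose_mul_le b y)
  have h2 : (s * ‖b‖) ^ 2 ≤ ‖A * b‖ ^ 2 := by
    gcongr; exact hA b
  rw [le_div_iff₀ (by positivity)]
  rcases (norm_nonneg b).eq_or_lt with h0 | h0
  · rw [← h0]; simp
  · refine le_of_mul_le_mul_left ?_ h0
    nlinarith

end NormalEquation

/-! ### Eigenvalues and singular vectors of the predictors -/

namespace FactorReg

open scoped Matrix.Norms.Frobenius

section Eigen

variable {n p r : ℕ} {X : Matrix (Fin n) (Fin p) ℝ} {W : Matrix (Fin p) (Fin p) ℝ}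
  {d : Fin p → ℝ}

/-- The minimax bound for the `r` largest eigenvalues. -/
lemma le_eigenvalue (hW : Wᵀ * W = 1) (hd : Antitone d) (hXW : Xᵀ * X * W = W * diagonal d)
    {L : Matrix (Fin p) (Fin r) ℝ} {c : ℝ} (hL : ∀ a : Matrix (Fin r) Unit ℝ, L * a = 0 → a = 0)
    (hc : ∀ a : Matrix (Fin r) Unit ℝ, c * ‖L * a‖ ^ 2 ≤ ‖X * (L * a)‖ ^ 2)
    (i : Fin p) (hi : (i : ℕ) < r) : c ≤ d i := by
  have hW' : W * Wᵀ = 1 := mul_eq_one_comm.1 hW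
  -- Coordinates of `L a` along the eigenvectors preceding index `i`. Counting from zero there are
  -- exactly `i < r` of them, so some nonzero `a` makes `L a` orthogonal to them all, and on such
  -- vectors the quadratic form of `XᵀX` is at most `d i`.
  let N : Matrix (Fin i) (Fin r) ℝ :=
    (Wᵀ * L).submatrix (Fin.castLE i.2.le) id
  have hker : LinearMap.ker N.mulVecLin ≠ ⊥ :=
    LinearMap.ker_ne_bot_of_finrank_lt (by simpa using hi)
  obtain ⟨v, hv, hv0⟩ := (Submodule.ne_bot_iff _).1 hker
  have hNv : N *ᵥ v = 0 := by simpa using hv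
  set a : Matrix (Fin r) Unit ℝ := replicateCol Unit v
  have ha : L * a ≠ 0 := fun h => hv0 <| by
    have := hL a h
    exact funext fun k => congrFun (congrFun this k) ()
  set b : Matrix (Fin p) Unit ℝ := Wᵀ * (L * a) with hb
  have hb0 : ∀ j : Fin p, j < i → b j () = 0 := fun j hj => by
    have h1 := congrFun hNv ⟨j, hj⟩
    rw [hb, ← Matrix.mul_assoc]
    exact h1
  have hbn : ‖b‖ = ‖L * a‖ :=
    frobenius_norm_isometry_mul (by rw [transpose_transpose, hW']) _
  have hXX : Xᵀ * X = W * diagonal d * Wᵀ := by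
    rw [← hXW, Matrix.mul_assoc, hW', Matrix.mul_one]
  have hX : ‖X * (L * a)‖ ^ 2 = ∑ j, d j * b j () ^ 2 := by
    have : ‖X * (L * a)‖ ^ 2 = (bᵀ * (diagonal d * b)).trace := by
      rw [frobenius_norm_sq_eq_trace, transpose_mul, Matrix.mul_assoc, ← Matrix.mul_assoc Xᵀ, hXX,
        hb]
      simp only [transpose_mul, transpose_transpose, Matrix.mul_assoc]
    rw [this]
    simp only [trace, diag_apply, Matrix.mul_apply (M := bᵀ), transpose_apply, diagonal_mul,
      Finset.univ_unique, Finset.sum_singleton]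
    exact Finset.sum_congr rfl fun j _ => by rw [show (default : Unit) = () from rfl]; ring
  have hle : ‖X * (L * a)‖ ^ 2 ≤ d i * ‖L * a‖ ^ 2 := by
    rw [hX, ← hbn, frobenius_norm_sq, Finset.mul_sum]
    refine Finset.sum_le_sum fun j _ => ?_
    simp only [Finset.univ_unique, Finset.sum_singleton]
    rcases lt_or_ge j i with h | h
    · rw [show (default : Unit) = () from rfl, hb0 j h]; simp
    · exact mul_le_mul_of_nonneg_right (hd h) (sq_nonneg _)
  exact le_of_mul_le_mul_right ((hc a).trans hle) (by positivity)

/-- The column space of the estimated factors is spanned by left singular vectors. -/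
lemma exists_singular_vectors (hn : 0 < n) (hp : 0 < p) (hW : Wᵀ * W = 1)
    (hXW : Xᵀ * X * W = W * diagonal d) (hd : ∀ i : Fin p, (i : ℕ) < r → 0 < d i) :
    ∃ U : Matrix (Fin n) {i : Fin p // (i : ℕ) < r} ℝ, Uᵀ * U = 1 ∧
      X * Xᵀ * U = U * diagonal (fun i : {i : Fin p // (i : ℕ) < r} => d i.1) ∧ colProj (facHat X W r) = U * Uᵀ := by
  let σ := {i : Fin p // (i : ℕ) < r}
  set Wr : Matrix (Fin p) σ ℝ := W.submatrix id Subtype.val with hWr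
  let dr : σ → ℝ := fun i => d i.1
  have hdr : ∀ i, 0 < dr i := fun i => hd i.1 i.2
  have hWrW : Wrᵀ * Wr = 1 := by
    have : Wrᵀ * Wr = (Wᵀ * W).submatrix Subtype.val Subtype.val := by
      ext i j; rfl
    rw [this, hW]
    exact submatrix_one _ Subtype.val_injective
  have hXWr : Xᵀ * X * Wr = Wr * diagonal dr := by
    have : Xᵀ * X * Wr = (Xᵀ * X * W).submatrix id Subtype.val := by
      ext i j; rfl
    rw [this, hXW]
    ext i j
    simp [Wr, dr, mul_diagonal]
  -- The columns of `X * Wr` are orthogonal with squared lengths `dr i`; `q` normalizes them.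
  set q : σ → ℝ := fun i => (Real.sqrt (dr i))⁻¹ with hq
  have hqs : ∀ i, Real.sqrt (dr i) ≠ 0 := fun i => (Real.sqrt_pos.2 (hdr i)).ne'
  set U : Matrix (Fin n) σ ℝ := X * Wr * diagonal q with hU
  have hUU : Uᵀ * U = 1 := by
    calc Uᵀ * U = diagonal q * (Wrᵀ * (Xᵀ * X * Wr)) * diagonal q := by
          rw [hU]; simp only [transpose_mul, diagonal_transpose, Matrix.mul_assoc]
      _ = diagonal q * diagonal dr * diagonal q := by
          rw [hXWr, ← Matrix.mul_assoc Wrᵀ, hWrW, Matrix.one_mul]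
      _ = 1 := by
          rw [diagonal_mul_diagonal, diagonal_mul_diagonal, ← diagonal_one]
          congr 1; ext i
          have := Real.mul_self_sqrt (hdr i).le
          have h2 := hqs i
          rw [hq]; field_simp; nlinarith
  have hXU : X * Wr = U * diagonal (fun i => Real.sqrt (dr i)) := by
    rw [hU, Matrix.mul_assoc (X * Wr), diagonal_mul_diagonal]
    conv_lhs => rw [← Matrix.mul_one (X * Wr), ← diagonal_one]
    congr 2; ext i; rw [hq]; exact (inv_mul_cancel₀ (hqs i)).symm
  refine ⟨U, hUU, ?_, ?_⟩
  · calc X * Xᵀ * U = X * (Xᵀ * X * Wr) * diagonal q := by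
          rw [hU]; simp only [Matrix.mul_assoc]
      _ = X * Wr * (diagonal dr * diagonal q) := by rw [hXWr]; simp only [Matrix.mul_assoc]
      _ = X * Wr * (diagonal q * diagonal dr) := by
          rw [diagonal_mul_diagonal, diagonal_mul_diagonal]; simp only [mul_comm]
      _ = U * diagonal dr := by rw [hU]; simp only [Matrix.mul_assoc]
  · have hp' : (0 : ℝ) < p := by exact_mod_cast hp
    have hn' : (0 : ℝ) < n := by exact_mod_cast hn
    set t : σ → ℝ := fun i => (p : ℝ)⁻¹ * Real.sqrt p * Real.sqrt (dr i) with ht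
    have ht0 : ∀ i, 0 < t i := fun i => by
      have := Real.sqrt_pos.2 (hdr i)
      positivity
    have hbar : facBar X W r = U * diagonal t := by
      rw [facBar, loadBar, Matrix.mul_smul, ← hWr, hXU, smul_smul, ← Matrix.mul_smul]
      congr 1; ext i j
      by_cases h : i = j
      · subst h; simp [ht]
      · simp [h]
    set s : σ → ℝ := fun i => Real.sqrt (n : ℝ)⁻¹ * t i with hs
    have hs0 : ∀ i, 0 < s i := fun i => by
      have := Real.sqrt_pos.2 (inv_pos.2 hn')
      exact mul_pos this (ht0 i)
    have hgram : (n : ℝ)⁻¹ • ((facBar X W r)ᵀ * facBar X W r) = diagonal fun i => s i ^ 2 := by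
      rw [hbar, transpose_mul, diagonal_transpose, Matrix.mul_assoc, ← Matrix.mul_assoc Uᵀ, hUU,
        Matrix.one_mul, diagonal_mul_diagonal, ← diagonal_smul]
      congr 1; ext i
      rw [hs]
      simp only [mul_pow, Pi.smul_apply, smul_eq_mul]
      rw [Real.sq_sqrt (inv_nonneg.2 hn'.le)]; ring
    have hhat : facHat X W r = U * diagonal fun i => t i * s i := by
      rw [facHat, hgram, cfc_sqrt_diagonal_sq s fun i => (hs0 i).le, hbar, Matrix.mul_assoc,
        diagonal_mul_diagonal]
    rw [hhat]
    exact colProj_mul_diagonal hUU fun i => (mul_pos (ht0 i) (hs0 i)).ne'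

end Eigen

end FactorReg

/-! ### Estimation of the factor space -/

namespace FactorReg

open scoped Matrix.Norms.Frobenius

/-- Orders of magnitude of the components of a factor model with sample size `N ^ 2` and `Q ^ 2`
predictors. -/
structure FactorBounds {n p r : ℕ} (F : Matrix (Fin n) (Fin r) ℝ) (L : Matrix (Fin p) (Fin r) ℝ)
    (e : Matrix (Fin n) (Fin p) ℝ) (K N Q : ℝ) : Prop where
  one_le_K : 1 ≤ K
  one_le_N : 1 ≤ N
  Q_large : 2 * K ^ 4 ≤ Q
  N_le : N ≤ K * Q
  norm_F : ‖F‖ ≤ K * N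
  gram_F : IsUnit (Fᵀ * F).det
  gram_F_inv : ‖(Fᵀ * F)⁻¹‖ ≤ K / N ^ 2
  norm_L : ‖L‖ ≤ K * Q
  gram_L : IsUnit (Lᵀ * L).det
  gram_L_inv : ‖(Lᵀ * L)⁻¹‖ ≤ K / Q ^ 2
  norm_eL : ‖e * L‖ ≤ K * (N * Q)
  norm_ee : ‖e * eᵀ‖ ≤ K * (Q ^ 2 * N)

namespace FactorBounds

variable {n p r : ℕ} {F : Matrix (Fin n) (Fin r) ℝ} {L : Matrix (Fin p) (Fin r) ℝ}
  {e : Matrix (Fin n) (Fin p) ℝ} {K N Q : ℝ}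

lemma Q_pos (h : FactorBounds F L e K N Q) : 0 < Q := by
  have := pow_pos (zero_lt_one.trans_le h.one_le_K) 4
  linarith [h.Q_large]

lemma injective (h : FactorBounds F L e K N Q) (a : Matrix (Fin r) Unit ℝ) (ha : L * a = 0) :
    a = 0 := by
  have h1 := norm_le_of_gram_inv h.gram_L a
  rw [Matrix.mul_assoc, ha] at h1
  simpa using h1

/-- Ensures that the index type of the first `r` eigenvectors really has `r` elements. -/
lemma card_le (h : FactorBounds F L e K N Q) : r ≤ p := by
  by_contra hlt
  have hker : LinearMap.ker L.mulVecLin ≠ ⊥ :=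
    LinearMap.ker_ne_bot_of_finrank_lt (by simpa using hlt)
  obtain ⟨v, hv, hv0⟩ := (Submodule.ne_bot_iff _).1 hker
  have hLv : L *ᵥ v = 0 := by simpa using hv
  have := h.injective (replicateCol Unit v) (by rw [← replicateCol_mulVec, hLv]; rfl)
  exact hv0 (funext fun k => congrFun (congrFun this k) ())

/-- On the column space of the loadings the factor part of `X` has strength of order `NQ`, and the
noise part is smaller by a factor of order `Q`. This is the input of the minimax bound. -/
lemma norm_mul_ge (h : FactorBounds F L e K N Q) (a : Matrix (Fin r) Unit ℝ) :
    N ^ 2 * Q ^ 2 / (4 * K ^ 8) * ‖L * a‖ ^ 2 ≤ ‖(F * Lᵀ + e) * (L * a)‖ ^ 2 := by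
  have hK : 0 < K := zero_lt_one.trans_le h.one_le_K
  have hN : 0 < N := zero_lt_one.trans_le h.one_le_N
  have hQ := h.Q_pos
  set x := ‖a‖
  have hx : 0 ≤ x := norm_nonneg a
  set y := ‖F * (Lᵀ * L * a)‖ with hy
  have h1 : N * Q ^ 2 * x ≤ K ^ 3 * y := by
    have e1 : x ≤ K / Q ^ 2 * ‖Lᵀ * L * a‖ :=
      (norm_le_of_gram_inv h.gram_L a).trans (by gcongr; exact h.gram_L_inv)
    have e2 : ‖Lᵀ * L * a‖ ≤ K / N ^ 2 * ‖Fᵀ * F * (Lᵀ * L * a)‖ :=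
      (norm_le_of_gram_inv h.gram_F _).trans (by gcongr; exact h.gram_F_inv)
    have e3 : ‖Fᵀ * F * (Lᵀ * L * a)‖ ≤ K * N * y := by
      rw [Matrix.mul_assoc]
      refine (frobenius_norm_mul _ _).trans ?_
      rw [frobenius_norm_transpose]
      gcongr; exact h.norm_F
    have e4 : x ≤ K / Q ^ 2 * (K / N ^ 2 * (K * N * y)) :=
      e1.trans (by gcongr; exact e2.trans (by gcongr))
    have e5 : K / Q ^ 2 * (K / N ^ 2 * (K * N * y)) = K ^ 3 * y / (N * Q ^ 2) := by
      field_simp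
    rw [e5, le_div_iff₀ (by positivity)] at e4
    linarith
  have h2 : ‖e * (L * a)‖ ≤ K * (N * Q) * x := by
    rw [← Matrix.mul_assoc]
    exact (frobenius_norm_mul _ _).trans (by gcongr; exact h.norm_eL)
  have h3 : ‖L * a‖ ≤ K * Q * x :=
    (frobenius_norm_mul _ _).trans (by gcongr; exact h.norm_L)
  have h4 : y ≤ ‖(F * Lᵀ + e) * (L * a)‖ + K * (N * Q) * x := by
    have : F * (Lᵀ * L * a) = (F * Lᵀ + e) * (L * a) - e * (L * a) := by
      rw [Matrix.add_mul, add_sub_cancel_right]; simp only [Matrix.mul_assoc]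
    rw [hy, this]
    exact (norm_sub_le _ _).trans (by gcongr)
  set z := ‖(F * Lᵀ + e) * (L * a)‖
  -- The condition `2 * K ^ 4 ≤ Q` lets half of the left side absorb the noise term.
  have h5 : N * Q ^ 2 * x ≤ 2 * K ^ 3 * z := by
    have e1 : 2 * K ^ 4 * (N * Q * x) ≤ Q * (N * Q * x) := by
      gcongr; exact h.Q_large
    have e2 := mul_le_mul_of_nonneg_left h4 (by positivity : 0 ≤ K ^ 3)
    nlinarith
  have h6 : N * Q * ‖L * a‖ ≤ 2 * K ^ 4 * z := by
    have := mul_le_mul_of_nonneg_left h3 (by positivity : 0 ≤ N * Q)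
    have e2 := mul_le_mul_of_nonneg_left h5 hK.le
    nlinarith
  have h7 : (N * Q * ‖L * a‖) ^ 2 ≤ (2 * K ^ 4 * z) ^ 2 := by gcongr
  rw [div_mul_eq_mul_div, div_le_iff₀ (by positivity)]
  nlinarith

/-- The space spanned by the estimated factors is a consistent estimator of the space spanned by
the factors. -/
lemma exists_orthProj (h : FactorBounds F L e K N Q) {W : Matrix (Fin p) (Fin p) ℝ}
    (hW : IsSortedEigenbasis ((F * Lᵀ + e)ᵀ * (F * Lᵀ + e)) W) (hn : 0 < n) (hp : 0 < p) :
    IsOrthProj (colProj (facHat (F * Lᵀ + e) W r)) ∧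
    (colProj (facHat (F * Lᵀ + e) W r)).trace = r ∧
    ‖(1 - colProj F) * colProj (facHat (F * Lᵀ + e) W r)‖ ≤ 8 * K ^ 11 * r / N := by
  have hK : 0 < K := zero_lt_one.trans_le h.one_le_K
  have hN : 0 < N := zero_lt_one.trans_le h.one_le_N
  have hQ := h.Q_pos
  obtain ⟨hWW, d, hd, hXW⟩ := hW
  set X := F * Lᵀ + e with hX
  set c := N ^ 2 * Q ^ 2 / (4 * K ^ 8) with hc
  have hc0 : 0 < c := by positivity
  have hdc : ∀ i : Fin p, (i : ℕ) < r → c ≤ d i :=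
    le_eigenvalue hWW hd hXW h.injective h.norm_mul_ge
  obtain ⟨U, hU, hXU, hP⟩ := exists_singular_vectors hn hp hWW hXW
    fun i hi => hc0.trans_le (hdc i hi)
  have hcard : Fintype.card {i : Fin p // (i : ℕ) < r} = r := by
    rw [Fintype.card_subtype, Fin.card_filter_val_lt, min_eq_right h.card_le]
  have hone : ‖(1 : Matrix {i : Fin p // (i : ℕ) < r} {i : Fin p // (i : ℕ) < r} ℝ)‖ ^ 2 = r := by
    rw [frobenius_norm_one_sq, hcard]
  have hUn : ‖U‖ = ‖(1 : Matrix {i : Fin p // (i : ℕ) < r} {i : Fin p // (i : ℕ) < r} ℝ)‖ := by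
    rw [← frobenius_norm_isometry_mul hU, Matrix.mul_one]
  set o := ‖(1 : Matrix {i : Fin p // (i : ℕ) < r} {i : Fin p // (i : ℕ) < r} ℝ)‖ with ho
  have ho0 : 0 ≤ o := norm_nonneg _
  rw [hP]
  refine ⟨isOrthProj_mul_transpose hU, ?_, ?_⟩
  · rw [trace_mul_comm, hU, trace_one, hcard]
  have hF := isOrthProj_colProj h.gram_F
  set T : Matrix {i : Fin p // (i : ℕ) < r} {i : Fin p // (i : ℕ) < r} ℝ :=
    diagonal fun i => (d i.1)⁻¹ with hT
  have hTn : ‖T‖ ≤ c⁻¹ * o := by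
    refine le_of_sq_le_sq ?_ (by positivity)
    rw [mul_pow, hone, frobenius_norm_sq]
    have e1 : ∀ i : {i : Fin p // (i : ℕ) < r}, ∑ j, T i j ^ 2 ≤ c⁻¹ ^ 2 := fun i => by
      rw [Finset.sum_eq_single i (fun j _ hj => by simp [hT, hj.symm]) (by simp)]
      simp only [hT, diagonal_apply_eq]
      have := hdc i.1 i.2
      gcongr
      exact inv_nonneg.2 (hc0.le.trans this)
    refine (Finset.sum_le_sum fun i _ => e1 i).trans ?_
    rw [Finset.sum_const, Finset.card_univ, hcard, nsmul_eq_mul, mul_comm]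
  -- Writing `U` through `X` lets `1 - colProj F` replace the leading `X` by the noise `e`, at the
  -- price of the inverse eigenvalues in `T`.
  have hUT : U = X * Xᵀ * (U * T) := by
    rw [← Matrix.mul_assoc, hXU, Matrix.mul_assoc, hT, diagonal_mul_diagonal]
    have : (diagonal fun i : {i : Fin p // (i : ℕ) < r} => d i.1 * (d i.1)⁻¹) = 1 := by
      rw [← diagonal_one]; congr 1; ext i
      exact mul_inv_cancel₀ (hc0.trans_le (hdc i.1 i.2)).ne'
    rw [this, Matrix.mul_one]
  have hres : (1 - colProj F) * X = (1 - colProj F) * e := by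
    rw [hX, Matrix.mul_add, ← Matrix.mul_assoc, Matrix.sub_mul 1 _ F, colProj_mul_self h.gram_F]
    simp
  have hnoise : ‖e * Xᵀ‖ ≤ 2 * K ^ 3 * (Q ^ 2 * N) := by
    have e1 : e * Xᵀ = e * L * Fᵀ + e * eᵀ := by
      rw [hX, transpose_add, transpose_mul, transpose_transpose, Matrix.mul_add, Matrix.mul_assoc]
    have e2 : ‖e * L * Fᵀ‖ ≤ K * (N * Q) * (K * N) := by
      refine (frobenius_norm_mul _ _).trans ?_
      rw [frobenius_norm_transpose]
      gcongr
      exacts [h.norm_eL, h.norm_F]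
    -- Here `n = O(p)` enters, in the form `N ≤ K * Q`.
    have e3 : K * (N * Q) * (K * N) ≤ K ^ 3 * (Q ^ 2 * N) := by
      have := mul_le_mul_of_nonneg_left h.N_le (by positivity : 0 ≤ K ^ 2 * N * Q)
      nlinarith
    have e4 : K * (Q ^ 2 * N) ≤ K ^ 3 * (Q ^ 2 * N) := by
      gcongr; exact le_self_pow₀ h.one_le_K (by norm_num)
    rw [e1]
    calc _ ≤ _ := norm_add_le _ _
      _ ≤ K ^ 3 * (Q ^ 2 * N) + K ^ 3 * (Q ^ 2 * N) :=
        add_le_add (e2.trans e3) (h.norm_ee.trans e4)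
      _ = _ := by ring
  have hfin : (1 - colProj F) * (U * Uᵀ) = (1 - colProj F) * (e * Xᵀ * (U * T) * Uᵀ) := by
    have : U * Uᵀ = X * Xᵀ * (U * T) * Uᵀ := by rw [← hUT]
    rw [this, Matrix.mul_assoc (X * Xᵀ), Matrix.mul_assoc X, ← Matrix.mul_assoc (1 - colProj F), hres]
    simp only [Matrix.mul_assoc]
  rw [hfin]
  calc ‖(1 - colProj F) * (e * Xᵀ * (U * T) * Uᵀ)‖ ≤ ‖e * Xᵀ * (U * T) * Uᵀ‖ :=
        hF.one_sub.norm_mul_le _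
    _ ≤ ‖e * Xᵀ‖ * ‖U * T‖ * ‖Uᵀ‖ :=
        (frobenius_norm_mul _ _).trans (by gcongr; exact frobenius_norm_mul _ _)
    _ ≤ 2 * K ^ 3 * (Q ^ 2 * N) * (c⁻¹ * o) * o := by
        rw [frobenius_norm_isometry_mul hU, frobenius_norm_transpose, hUn]
        gcongr
    _ = 2 * K ^ 3 * (Q ^ 2 * N) * c⁻¹ * o ^ 2 := by ring
    -- The constant is `2 K³` from the noise times `4 K⁸` from `c⁻¹`; `r` is the squared norm of the
    -- identity.
    _ = 8 * K ^ 11 * r / N := by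
        rw [hone, hc]; field_simp; ring

/-- As `F = colProj F * F`, only `(1 - P) * colProj F` matters, and equality of ranks turns it into
the defect already bounded. -/
lemma norm_residual_factors_le (h : FactorBounds F L e K N Q) {P : Matrix (Fin n) (Fin n) ℝ}
    {D : ℝ} (hP : IsOrthProj P) (htr : P.trace = r) (hPF : ‖(1 - colProj F) * P‖ ≤ D / N) :
    ‖(1 - P) * F‖ ≤ D * K := by
  have hN : 0 < N := zero_lt_one.trans_le h.one_le_N
  have hF := isOrthProj_colProj h.gram_F
  calc ‖(1 - P) * F‖ = ‖(1 - P) * colProj F * F‖ := by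
        rw [Matrix.mul_assoc, colProj_mul_self h.gram_F]
    _ ≤ ‖(1 - colProj F) * P‖ * ‖F‖ := by
        rw [← hP.norm_one_sub_mul_comm hF (by rw [htr, trace_colProj h.gram_F, Fintype.card_fin])]
        exact frobenius_norm_mul _ _
    _ ≤ D / N * (K * N) := by
        gcongr
        · exact (norm_nonneg _).trans hPF
        · exact h.norm_F
    _ = D * K := by field_simp

/-- Split `E` along `colProj F`. The part inside is small because `E` is nearly uncorrelated with
`F`; on the part outside `P` contributes a factor `D / N`. Both gain a factor `N` over `‖E‖`. -/
lemma norm_proj_noise_le (h : FactorBounds F L e K N Q) {P : Matrix (Fin n) (Fin n) ℝ}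
    {D S : ℝ} (hP : IsOrthProj P) (hPF : ‖(1 - colProj F) * P‖ ≤ D / N)
    {σ : Type*} [Fintype σ] {E : Matrix (Fin n) σ ℝ} (hE : ‖E‖ ≤ K * (S * N))
    (hFE : ‖Fᵀ * E‖ ≤ K * (S * N)) : ‖P * E‖ ≤ (K ^ 3 + D * K) * S := by
  have hN : 0 < N := zero_lt_one.trans_le h.one_le_N
  have hK : 0 < K := zero_lt_one.trans_le h.one_le_K
  have hF := isOrthProj_colProj h.gram_F
  have h1 : P * E = P * (colProj F * E) + P * (1 - colProj F) * E := by
    rw [Matrix.mul_assoc, ← Matrix.mul_add, ← Matrix.add_mul]; simp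
  have h2 : ‖P * (1 - colProj F)‖ ≤ D / N := by
    rw [← frobenius_norm_transpose, transpose_mul, hP.symm, hF.one_sub.symm]; exact hPF
  have h3 : ‖P * (colProj F * E)‖ ≤ K ^ 3 * S := by
    calc _ ≤ ‖colProj F * E‖ := hP.norm_mul_le _
      _ = ‖F * (Fᵀ * F)⁻¹ * (Fᵀ * E)‖ := by rw [colProj, Matrix.mul_assoc _ Fᵀ]
      _ ≤ ‖F‖ * ‖(Fᵀ * F)⁻¹‖ * ‖Fᵀ * E‖ :=
        (frobenius_norm_mul _ _).trans (by gcongr; exact frobenius_norm_mul _ _)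
      _ ≤ K * N * (K / N ^ 2) * (K * (S * N)) := by
        gcongr
        exacts [h.norm_F, h.gram_F_inv]
      _ = K ^ 3 * S := by field_simp
  have h4 : ‖P * (1 - colProj F) * E‖ ≤ D * K * S := by
    calc _ ≤ _ := frobenius_norm_mul _ _
      _ ≤ D / N * (K * (S * N)) := by
        gcongr
        exact (norm_nonneg _).trans h2
      _ = D * K * S := by field_simp
  rw [h1]
  exact (norm_add_le _ _).trans (by linarith)

end FactorBounds

end FactorReg

/-! ### Deterministic bound for the regression error -/

namespace FactorReg

open scoped Matrix.Norms.Frobenius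

section Deterministic

variable {n p r : ℕ}

/-- Since `1 - P` is idempotent, `Tᵀ X_J = Tᵀ T`; the signal `b` is reproduced exactly and the error
solves the normal equations with right side `Tᵀ z`. -/
lemma vecNorm_betaTilde_sub_le {X : Matrix (Fin n) (Fin p) ℝ} {W : Matrix (Fin p) (Fin p) ℝ}
    {k : ℕ} {J : Finset (Fin p)} (hP : IsOrthProj (colProj (facHat X W k))) {s : ℝ} (hs : 0 < s)
    (hX : ∀ a : Matrix J Unit ℝ, s * ‖a‖ ≤ ‖xTilde X W k J * a‖) {Y z : Fin n → ℝ} {b : J → ℝ}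
    (hY : Y = cols X J *ᵥ b + z) :
    vecNorm (betaTilde X W k J Y - b) ≤
      ‖(xTilde X W k J)ᵀ * replicateCol Unit z‖ / s ^ 2 := by
  set T := xTilde X W k J with hT
  have hTX : Tᵀ * cols X J = Tᵀ * T := by
    have h1 : T = (1 - colProj (facHat X W k)) * cols X J := rfl
    rw [h1, transpose_mul, hP.one_sub.symm, Matrix.mul_assoc, Matrix.mul_assoc,
      ← Matrix.mul_assoc (1 - _) (1 - _), hP.one_sub.idem]
  have hu := isUnit_det_gram hs hX
  rw [vecNorm_eq]
  refine norm_le_of_normal_equation hs hX ?_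
  rw [← replicateCol_mulVec, ← replicateCol_mulVec, mulVec_sub, betaTilde, ← hT, mulVec_mulVec,
    Matrix.mul_nonsing_inv _ hu, one_mulVec, hY, mulVec_add, mulVec_mulVec, hTX,
    add_sub_cancel_left]

variable {F : Matrix (Fin n) (Fin r) ℝ} {L : Matrix (Fin p) (Fin r) ℝ}
  {e : Matrix (Fin n) (Fin p) ℝ} {K N Q : ℝ}

/-- The error of the estimator with `r` estimated factors is of order `S / N`, where `S ^ 2` is the
order of the number of selected predictors. -/
lemma FactorBounds.vecNorm_betaTilde_sub_le (h : FactorBounds F L e K N Q)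
    {W : Matrix (Fin p) (Fin p) ℝ}
    (hW : IsSortedEigenbasis ((F * Lᵀ + e)ᵀ * (F * Lᵀ + e)) W) (hn : 0 < n) (hp : 0 < p)
    {J : Finset (Fin p)} {S κ A : ℝ} (hS : 0 ≤ S) (hκ : 0 < κ)
    (hA : A = K ^ 3 + 8 * K ^ 11 * r * K)
    (hLJ : ‖cols Lᵀ J‖ ≤ K * S) (heJ : ‖cols e J‖ ≤ K * (S * N))
    (hFe : ‖Fᵀ * cols e J‖ ≤ K * (S * N))
    (hG : ∀ a : Matrix J Unit ℝ, κ * N * ‖a‖ ≤ ‖cols e J * a‖)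
    (hSN : 2 * (A * K + A) * S ≤ κ * N)
    {Y w : Fin n → ℝ} {b : J → ℝ} {q : Fin r → ℝ}
    (hq : vecNorm q ≤ K) (hw : vecNorm w ≤ K * N)
    (hew : vecNorm ((cols e J)ᵀ *ᵥ w) ≤ K * (S * N))
    (hY : Y = cols (F * Lᵀ + e) J *ᵥ b + (F *ᵥ q + w)) :
    vecNorm (betaTilde (F * Lᵀ + e) W r J Y - b) ≤
      4 * (A * K * (A * K + K) + A * K ^ 2 + K + A * K) / κ ^ 2 * (S / N) := by
  have hK : 0 < K := zero_lt_one.trans_le h.one_le_K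
  have hN1 := h.one_le_N
  have hN : 0 < N := zero_lt_one.trans_le hN1
  obtain ⟨hP, htr, hPF⟩ := h.exists_orthProj hW hn hp
  have hr : (0 : ℝ) ≤ r := r.cast_nonneg
  have hA0 : 0 < A := by rw [hA]; positivity
  set X := F * Lᵀ + e with hX
  set P := colProj (facHat X W r) with hPdef
  have hMF : ‖(1 - P) * F‖ ≤ A := by
    refine (h.norm_residual_factors_le hP htr hPF).trans ?_
    rw [hA]; linarith [pow_pos hK 3]
  have hPE : ‖P * cols e J‖ ≤ A * S := by
    rw [hA]; exact h.norm_proj_noise_le hP hPF heJ hFe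
  set T := xTilde X W r J with hT
  have hTP : T = (1 - P) * cols X J := rfl
  have hcX : cols X J = F * cols Lᵀ J + cols e J := by
    ext i j; simp [hX, cols, mul_apply]
  have hT2 : T = (1 - P) * F * cols Lᵀ J + cols e J - P * cols e J := by
    rw [hTP, hcX, Matrix.mul_add, ← Matrix.mul_assoc, Matrix.sub_mul 1 P (cols e J),
      Matrix.one_mul, add_sub_assoc]
  have hML : ‖(1 - P) * F * cols Lᵀ J‖ ≤ A * (K * S) :=
    (frobenius_norm_mul _ _).trans (by gcongr)
  -- The two differences between `T` and `cols e J` cost at most half of the coercivity, by `hSN`.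
  -- Squaring this half gives the factor 4 in the final constant.
  have hcoer : ∀ a : Matrix J Unit ℝ, κ * N / 2 * ‖a‖ ≤ ‖T * a‖ := fun a => by
    have h1 : cols e J * a = T * a - (1 - P) * F * cols Lᵀ J * a + P * cols e J * a := by
      rw [hT2, Matrix.sub_mul, Matrix.add_mul]; abel
    have h2 : ‖cols e J * a‖ ≤ ‖T * a‖ + A * (K * S) * ‖a‖ + A * S * ‖a‖ := by
      rw [h1]
      refine (norm_add_le _ _).trans (add_le_add ((norm_sub_le _ _).trans ?_) ?_)
      · gcongr
        exact (frobenius_norm_mul _ _).trans (by gcongr)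
      · exact (frobenius_norm_mul _ _).trans (by gcongr)
    have h3 := mul_le_mul_of_nonneg_right hSN (norm_nonneg a)
    nlinarith [hG a]
  have hTn : ‖T‖ ≤ (A * K + K) * (S * N) := by
    have h1 : T = (1 - P) * (F * cols Lᵀ J) + (1 - P) * cols e J := by
      rw [hTP, hcX, Matrix.mul_add]
    have h2 := hP.one_sub.norm_mul_le (cols e J)
    have h3 : S ≤ S * N := le_mul_of_one_le_right hS hN1
    have h4 : A * (K * S) ≤ A * (K * (S * N)) := by gcongr
    rw [h1, ← Matrix.mul_assoc]
    calc _ ≤ _ := norm_add_le _ _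
      _ ≤ A * (K * (S * N)) + K * (S * N) := add_le_add (hML.trans h4) (h2.trans heJ)
      _ = _ := by ring
  rw [vecNorm_eq] at hq hw hew
  have hz : ‖Tᵀ * replicateCol Unit (F *ᵥ q + w)‖ ≤
      (A * K * (A * K + K) + A * K ^ 2 + K + A * K) * (S * N) := by
    -- A second copy of `1 - P` is inserted before `F`, so that only the bounded matrix `(1 - P) *
    -- F` meets `q`. In the `w` part `T` is expanded, to isolate `(cols e J)ᵀ w`, whose order is
    -- smaller than the product of the norms.
    have h1 : Tᵀ * replicateCol Unit (F *ᵥ q + w) = Tᵀ * ((1 - P) * F * replicateCol Unit q) +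
        ((1 - P) * F * cols Lᵀ J)ᵀ * replicateCol Unit w +
        replicateCol Unit ((cols e J)ᵀ *ᵥ w) - (P * cols e J)ᵀ * replicateCol Unit w := by
      have h2 : Tᵀ = Tᵀ * (1 - P) := by
        rw [hTP, transpose_mul, hP.one_sub.symm, Matrix.mul_assoc, hP.one_sub.idem]
      have h3 : Tᵀ * replicateCol Unit (F *ᵥ q) = Tᵀ * ((1 - P) * F * replicateCol Unit q) := by
        conv_lhs => rw [h2]
        rw [replicateCol_mulVec]; simp only [Matrix.mul_assoc]
      rw [replicateCol_add, Matrix.mul_add, h3, replicateCol_mulVec, add_assoc, add_sub_assoc,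
        hT2]
      simp only [transpose_sub, transpose_add, Matrix.sub_mul, Matrix.add_mul]
    have e1 : ‖Tᵀ * ((1 - P) * F * replicateCol Unit q)‖ ≤ (A * K + K) * (S * N) * (A * K) := by
      refine (frobenius_norm_mul _ _).trans ?_
      rw [frobenius_norm_transpose]
      gcongr
      exact (frobenius_norm_mul _ _).trans (by gcongr)
    have e2 : ‖((1 - P) * F * cols Lᵀ J)ᵀ * replicateCol Unit w‖ ≤ A * (K * S) * (K * N) := by
      refine (frobenius_norm_mul _ _).trans ?_
      rw [frobenius_norm_transpose]
      gcongr
    have e3 : ‖(P * cols e J)ᵀ * replicateCol Unit w‖ ≤ A * S * (K * N) := by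
      refine (frobenius_norm_mul _ _).trans ?_
      rw [frobenius_norm_transpose]
      gcongr
    rw [h1]
    calc _ ≤ _ := norm_sub_le _ _
      _ ≤ (A * K + K) * (S * N) * (A * K) + A * (K * S) * (K * N) + K * (S * N) +
          A * S * (K * N) :=
        add_le_add ((norm_add_le _ _).trans (add_le_add ((norm_add_le _ _).trans
          (add_le_add e1 e2)) hew)) e3
      _ = _ := by ring
  refine (FactorReg.vecNorm_betaTilde_sub_le hP (by positivity) hcoer hY).trans ?_
  calc _ ≤ (A * K * (A * K + K) + A * K ^ 2 + K + A * K) * (S * N) / (κ * N / 2) ^ 2 := by gcongr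
    _ = _ := by field_simp; ring

end Deterministic

end FactorReg

/-! ### Bounds in probability -/

namespace FactorReg

section Probability

variable {Ω : Type*} [MeasurableSpace Ω] {μ : Measure Ω}

/-- The event `A C n` has a probability arbitrarily close to one when `C` is large and then `n` is
large. -/
def HoldsInProb (μ : Measure Ω) (A : ℝ → ℕ → Ω → Prop) : Prop :=
  ∀ η : ℝ, 0 < η → ∀ᶠ C in atTop, ∀ᶠ n in atTop, μ {ω | ¬ A C n ω} ≤ ENNReal.ofReal η

namespace HoldsInProb

variable {A B : ℝ → ℕ → Ω → Prop}

lemma mono (hA : HoldsInProb μ A)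
    (h : ∀ᶠ C in atTop, ∀ᶠ n in atTop, ∀ ω, A C n ω → B C n ω) : HoldsInProb μ B := by
  intro η hη
  filter_upwards [hA η hη, h] with C h1 h2
  filter_upwards [h1, h2] with n h3 h4
  refine (measure_mono fun ω hω => ?_).trans h3
  simp only [Set.mem_ofPred_eq] at hω ⊢
  exact fun hA => hω (h4 ω hA)

/-- Every large `C` is admissible, so several bounds can share one constant. -/
lemma and (hA : HoldsInProb μ A) (hB : HoldsInProb μ B) :
    HoldsInProb μ fun C n ω => A C n ω ∧ B C n ω := by
  intro η hη
  filter_upwards [hA (η / 2) (half_pos hη), hB (η / 2) (half_pos hη)] with C h1 h2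
  filter_upwards [h1, h2] with n h3 h4
  have hsub : {ω | ¬ (A C n ω ∧ B C n ω)} ⊆ {ω | ¬ A C n ω} ∪ {ω | ¬ B C n ω} := by
    intro ω hω
    simp only [Set.mem_ofPred_eq, Set.mem_union] at hω ⊢
    tauto
  calc _ ≤ _ := measure_mono hsub
    _ ≤ _ := measure_union_le _ _
    _ ≤ ENNReal.ofReal (η / 2) + ENNReal.ofReal (η / 2) := add_le_add h3 h4
    _ = ENNReal.ofReal η := by
      rw [← ENNReal.ofReal_add (half_pos hη).le (half_pos hη).le, add_halves]

lemma isBigOp {Z : ℕ → Ω → ℝ} {a : ℕ → ℝ} {g : ℝ → ℝ} (hZ : ∀ n ω, 0 ≤ Z n ω)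
    (h : HoldsInProb μ fun C n ω => Z n ω ≤ g C * a n) : IsBigOp μ Z a := by
  intro η hη
  obtain ⟨C, hC⟩ := (h η hη).exists
  refine ⟨g C, hC.mono fun n hn => (measure_mono fun ω hω => ?_).trans hn⟩
  rw [Set.mem_ofPred_eq, abs_of_nonneg (hZ n ω)] at hω
  exact not_le.2 hω

end HoldsInProb

/-- Markov's inequality. -/
lemma measure_lt_le_of_integral_le [IsFiniteMeasure μ] {Z : Ω → ℝ} (hZ : ∀ ω, 0 ≤ Z ω)
    (hi : Integrable Z μ) {a B C : ℝ} (ha : 0 ≤ a) (hC : 0 < C) (hB : ∫ ω, Z ω ∂μ ≤ B * a) :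
    μ {ω | C * a < Z ω} ≤ ENNReal.ofReal (B / C) := by
  -- The scale `a` vanishes when the selection set is empty. Then `Z = 0` almost everywhere, and the
  -- strict inequality makes the event null.
  rcases ha.eq_or_lt with rfl | ha
  · have h0 : ∫ ω, Z ω ∂μ = 0 := le_antisymm (by simpa using hB) (integral_nonneg hZ)
    rw [integral_eq_zero_iff_of_nonneg hZ hi] at h0
    have : μ {ω | C * 0 < Z ω} = 0 := by
      refine measure_mono_null (fun ω hω => ?_) (ae_iff.1 h0)
      simp only [mul_zero, Set.mem_ofPred_eq] at hω
      exact hω.ne'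
    rw [this]; exact zero_le
  · have h1 := mul_meas_ge_le_integral_of_nonneg (ae_of_all μ hZ) hi (C * a)
    have h2 : μ.real {ω | C * a ≤ Z ω} ≤ B / C := by
      rw [le_div_iff₀ hC]
      refine le_of_mul_le_mul_right ?_ ha
      linarith [h1.trans hB]
    have h3 : {ω | C * a < Z ω} ⊆ {ω | C * a ≤ Z ω} := fun ω hω => by
      simp only [Set.mem_ofPred_eq] at hω ⊢
      exact hω.le
    calc _ ≤ _ := measure_mono h3
      _ = ENNReal.ofReal (μ.real {ω | C * a ≤ Z ω}) := by
        rw [measureReal_def, ENNReal.ofReal_toReal (measure_ne_top _ _)]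
      _ ≤ _ := ENNReal.ofReal_le_ofReal h2

/-- A bound in mean square gives a bound in probability. -/
lemma holdsInProb_of_expLe_sq [IsFiniteMeasure μ] {Z : ℕ → Ω → ℝ} {a : ℕ → ℝ} {B : ℝ}
    (ha : ∀ n, 0 ≤ a n)
    (h : ∀ᶠ n in atTop, ∃ R : Ω → ℝ, (∀ ω, Z n ω ^ 2 ≤ R ω) ∧ ExpLe μ R (B * a n ^ 2)) :
    HoldsInProb μ fun C n ω => Z n ω ≤ C * a n := by
  intro η hη
  filter_upwards [eventually_ge_atTop (max 1 (B / η))] with C hC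
  have hC1 : 1 ≤ C := (le_max_left _ _).trans hC
  have hCη : B / C ≤ η := by
    have := (le_max_right _ _).trans hC
    rw [div_le_iff₀ hη] at this
    rw [div_le_iff₀ (by linarith)]; linarith
  filter_upwards [h] with n ⟨R, hR, hi, hB⟩
  have h1 := measure_lt_le_of_integral_le (fun ω => (sq_nonneg (Z n ω)).trans (hR ω)) hi
    (sq_nonneg (a n)) (by linarith : 0 < C) hB
  refine (measure_mono fun ω hω => ?_).trans (h1.trans (ENNReal.ofReal_le_ofReal hCη))
  simp only [Set.mem_ofPred_eq, not_le] at hω ⊢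
  have h2 : (C * a n) ^ 2 < Z n ω ^ 2 :=
    pow_lt_pow_left₀ hω (mul_nonneg (by linarith) (ha n)) two_ne_zero
  have h3 : C * a n ^ 2 ≤ (C * a n) ^ 2 := by
    rw [mul_pow]; exact mul_le_mul_of_nonneg_right (le_self_pow₀ hC1 two_ne_zero) (sq_nonneg _)
  exact (h3.trans_lt h2).trans_le (hR ω)

lemma holdsInProb_of_tendstoInMeasure {Z : ℕ → Ω → ℝ} {A : ℝ → ℕ → Ω → Prop}
    (h : TendstoInMeasure μ Z atTop fun _ => 0) {δ : ℝ} (hδ : 0 < δ)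
    (hA : ∀ᶠ C in atTop, ∀ᶠ n in atTop, ∀ ω, Z n ω < δ → A C n ω) : HoldsInProb μ A := by
  intro η hη
  have h1 := (h (ENNReal.ofReal δ) (ENNReal.ofReal_pos.2 hδ)).eventually
    (eventually_le_nhds (ENNReal.ofReal_pos.2 hη))
  filter_upwards [hA] with C hC
  filter_upwards [hC, h1] with n h2 h3
  refine (measure_mono fun ω hω => ?_).trans h3
  have h4 : δ ≤ Z n ω := le_of_not_gt fun h => hω (h2 ω h)
  rw [Set.mem_ofPred_eq, edist_dist, Real.dist_eq, sub_zero]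
  exact ENNReal.ofReal_le_ofReal (h4.trans (le_abs_self _))

lemma IsBigOp.tendstoInMeasure {Z : ℕ → Ω → ℝ} {a : ℕ → ℝ} (h : IsBigOp μ Z a)
    (ha : Tendsto a atTop (𝓝 0)) : TendstoInMeasure μ Z atTop fun _ => 0 := by
  refine tendstoInMeasure_of_ne_top fun ε hε hε' => ?_
  have hε0 : 0 < ε.toReal := ENNReal.toReal_pos hε.ne' hε'
  rw [ENNReal.tendsto_nhds_zero]
  intro η hη
  rcases eq_or_ne η ⊤ with rfl | hη'
  · simp
  obtain ⟨C, hC⟩ := h η.toReal (ENNReal.toReal_pos hη.ne' hη')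
  have h1 : Tendsto (fun n => C * a n) atTop (𝓝 0) := by simpa using ha.const_mul C
  filter_upwards [hC, h1.eventually (eventually_lt_nhds hε0)] with n h2 h3
  rw [ENNReal.ofReal_toReal hη'] at h2
  refine (measure_mono fun ω hω => ?_).trans h2
  rw [Set.mem_ofPred_eq, edist_dist, Real.dist_eq, sub_zero] at hω
  exact h3.trans_le ((ENNReal.le_ofReal_iff_toReal_le hε' (abs_nonneg _)).1 hω)

/-- A bound that holds given an event of probability bounded away from zero. -/
lemma IsBigOp.conditional {Z : ℕ → Ω → ℝ} {a : ℕ → ℝ} (h : IsBigOp μ Z a) (D : ℕ → Set Ω)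
    {η δ : ℝ} (hη : 0 < η) (hδ : 0 < δ) :
    ∃ C : ℝ, ∀ᶠ n in atTop, ENNReal.ofReal δ ≤ μ (D n) →
      μ {ω | ω ∈ D n ∧ C * a n < Z n ω} ≤ ENNReal.ofReal η * μ (D n) := by
  -- The tolerance `η * δ` is at most `η * μ (D n)` whenever `D n` has probability at least `δ`.
  obtain ⟨C, hC⟩ := h (η * δ) (mul_pos hη hδ)
  refine ⟨C, hC.mono fun n hn hD => ?_⟩
  calc _ ≤ μ {ω | C * a n < |Z n ω|} := measure_mono fun ω hω => hω.2.trans_le (le_abs_self _)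
    _ ≤ ENNReal.ofReal (η * δ) := hn
    _ = ENNReal.ofReal η * ENNReal.ofReal δ := ENNReal.ofReal_mul hη.le
    _ ≤ _ := by gcongr

end Probability

open scoped Matrix.Norms.Frobenius

/-! ### Perturbation of Gram matrices -/

section Perturbation

variable {ρ : Type*} [Fintype ρ] [DecidableEq ρ]

/-- Matrices close to an invertible matrix are invertible, with bounded inverses. -/
lemma exists_forall_norm_sub_lt_inv {G : Matrix ρ ρ ℝ} (hG : IsUnit G.det) :
    ∃ δ > 0, ∃ C : ℝ, ∀ A : Matrix ρ ρ ℝ, ‖A - G‖ < δ →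
      IsUnit A.det ∧ ‖A⁻¹‖ ≤ C ∧ ‖A‖ ≤ C := by
  set k := ‖G⁻¹‖ + 1 with hk
  have hk0 : 0 < k := by positivity
  refine ⟨1 / (2 * k), by positivity,
    max (2 * k * ‖(1 : Matrix ρ ρ ℝ)‖) (‖G‖ + 1 / (2 * k)), fun A hA => ?_⟩
  -- The radius `1 / (2 * k)` lets half of `‖B‖` absorb the perturbation. Copies of a kernel vector
  -- as `B` give invertibility, and `B = A⁻¹` gives the bound for the inverse.
  have key : ∀ {ν : Type _} [Fintype ν] (B : Matrix ρ ν ℝ), ‖B‖ ≤ 2 * k * ‖A * B‖ := by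
    intro ν _ B
    have h1 : ‖B‖ ≤ k * ‖G * B‖ :=
      (norm_le_of_gram_inv hG B).trans (by gcongr; simp [hk])
    have h2 : ‖G * B‖ ≤ ‖A * B‖ + 1 / (2 * k) * ‖B‖ := by
      have : G * B = A * B - (A - G) * B := by rw [Matrix.sub_mul]; abel
      rw [this]
      exact (norm_sub_le _ _).trans
        (by gcongr; exact (frobenius_norm_mul _ _).trans (by gcongr))
    have h3 : k * (1 / (2 * k) * ‖B‖) = ‖B‖ / 2 := by field_simp
    have h4 := mul_le_mul_of_nonneg_left h2 hk0.le
    rw [mul_add, h3] at h4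
    linarith
  have hu : IsUnit A.det := by
    rw [isUnit_iff_ne_zero]
    intro h0
    obtain ⟨v, hv, hv0⟩ := exists_mulVec_eq_zero_iff.2 h0
    have h1 : ‖replicateCol ρ v‖ ≤ 2 * k * ‖A * replicateCol ρ v‖ := key _
    rw [← replicateCol_mulVec, hv0] at h1
    have h2 : replicateCol ρ v = 0 := norm_le_zero_iff.1 (h1.trans (by
      rw [show replicateCol ρ (0 : ρ → ℝ) = 0 from rfl, norm_zero, mul_zero]))
    exact hv (funext fun i => congrFun (congrFun h2 i) i)
  refine ⟨hu, ?_, ?_⟩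
  · have := key A⁻¹
    rw [Matrix.mul_nonsing_inv _ hu] at this
    exact this.trans (le_max_left _ _)
  · have h1 : ‖A‖ ≤ ‖G‖ + ‖A - G‖ := by
      have := norm_add_le G (A - G)
      rwa [add_sub_cancel] at this
    exact (h1.trans (by linarith)).trans (le_max_right _ _)

/-- Bounds for a matrix with a well-conditioned normalized Gram matrix. -/
lemma exists_forall_gram_bounds {G : Matrix ρ ρ ℝ} (hG : IsUnit G.det) :
    ∃ δ > 0, ∃ C : ℝ, ∀ (n : ℕ), 0 < n → ∀ A : Matrix (Fin n) ρ ℝ,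
      ‖(n : ℝ)⁻¹ • (Aᵀ * A) - G‖ < δ →
      IsUnit (Aᵀ * A).det ∧ ‖(Aᵀ * A)⁻¹‖ ≤ C / n ∧ ‖A‖ ≤ C * Real.sqrt n := by
  obtain ⟨δ, hδ, C, hC⟩ := exists_forall_norm_sub_lt_inv hG
  set o := ‖(1 : Matrix ρ ρ ℝ)‖ with ho
  refine ⟨δ, hδ, max C (Real.sqrt (o * C)), fun n hn A hA => ?_⟩
  have hn' : (0 : ℝ) < n := by exact_mod_cast hn
  obtain ⟨h1, h2, h3⟩ := hC _ hA
  set H := (n : ℝ)⁻¹ • (Aᵀ * A) with hH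
  have hAH : Aᵀ * A = (n : ℝ) • H := by rw [hH, smul_smul, mul_inv_cancel₀ hn'.ne', one_smul]
  have hu : IsUnit (Aᵀ * A).det := by
    rw [hAH, det_smul]
    exact (isUnit_iff_ne_zero.2 (pow_ne_zero _ hn'.ne')).mul h1
  refine ⟨hu, ?_, ?_⟩
  · have h4 : (Aᵀ * A)⁻¹ = (n : ℝ)⁻¹ • H⁻¹ := by
      refine Matrix.inv_eq_right_inv ?_
      rw [hAH, Matrix.smul_mul, Matrix.mul_smul, smul_smul, mul_inv_cancel₀ hn'.ne', one_smul,
        Matrix.mul_nonsing_inv _ h1]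
    rw [h4, norm_smul, norm_inv, RCLike.norm_natCast, div_eq_inv_mul]
    gcongr
    exact h2.trans (le_max_left _ _)
  · have h4 : ‖A‖ ^ 2 ≤ o * C * n := by
      rw [frobenius_norm_sq_eq_trace, hAH, trace_smul, smul_eq_mul, mul_comm]
      gcongr
      have := (le_abs_self _).trans (abs_trace_transpose_mul_le (1 : Matrix ρ ρ ℝ) H)
      rw [transpose_one, Matrix.one_mul] at this
      exact this.trans (by gcongr)
    have h5 : ‖A‖ ≤ Real.sqrt (o * C * n) := Real.le_sqrt_of_sq_le h4
    rw [Real.sqrt_mul' _ hn'.le] at h5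
    exact h5.trans (by gcongr; exact le_max_right _ _)

/-- A matrix whose normalized Gram matrix is close to a uniformly positive one is coercive. -/
lemma norm_mul_ge_of_gram {n : ℕ} (hn : 0 < n) {σ : Type*} [Fintype σ] [DecidableEq σ]
    {E : Matrix (Fin n) σ ℝ} {G : Matrix σ σ ℝ} {c : ℝ} (hc : 0 < c)
    (hG : (G - c • (1 : Matrix σ σ ℝ)).PosSemidef)
    (hE : ‖(n : ℝ)⁻¹ • (Eᵀ * E) - G‖ < c / 2) (a : Matrix σ Unit ℝ) :
    Real.sqrt (c / 2) * Real.sqrt n * ‖a‖ ≤ ‖E * a‖ := by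
  have hn' : (0 : ℝ) < n := by exact_mod_cast hn
  set H := (n : ℝ)⁻¹ • (Eᵀ * E) with hH
  have hEH : Eᵀ * E = (n : ℝ) • H := by rw [hH, smul_smul, mul_inv_cancel₀ hn'.ne', one_smul]
  have h1 : ‖E * a‖ ^ 2 = n * (aᵀ * (H * a)).trace := by
    rw [frobenius_norm_sq_eq_trace, transpose_mul, Matrix.mul_assoc, ← Matrix.mul_assoc Eᵀ, hEH,
      Matrix.smul_mul, Matrix.mul_smul, trace_smul, smul_eq_mul]
  have h2 : c * ‖a‖ ^ 2 ≤ (aᵀ * (G * a)).trace := by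
    have h3 := (hG.conjTranspose_mul_mul_same a).trace_nonneg
    rw [conjTranspose_eq_transpose_of_trivial, Matrix.mul_assoc, Matrix.sub_mul, Matrix.mul_sub,
      trace_sub, Matrix.smul_mul, Matrix.one_mul, Matrix.mul_smul, trace_smul, smul_eq_mul,
      ← frobenius_norm_sq_eq_trace] at h3
    linarith
  -- The perturbation takes at most half of the lower bound `c` provided by `G`.
  have h4 : |(aᵀ * ((H - G) * a)).trace| ≤ c / 2 * ‖a‖ ^ 2 := by
    refine (abs_trace_transpose_mul_le _ _).trans ?_
    have h5 : ‖(H - G) * a‖ ≤ c / 2 * ‖a‖ := (frobenius_norm_mul _ _).trans (by gcongr)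
    nlinarith [mul_le_mul_of_nonneg_left h5 (norm_nonneg a)]
  rw [Matrix.sub_mul, Matrix.mul_sub, trace_sub] at h4
  have h6 := (abs_le.1 h4).1
  refine le_of_sq_le_sq ?_ (norm_nonneg _)
  rw [mul_pow, mul_pow, Real.sq_sqrt (by positivity), Real.sq_sqrt hn'.le, h1]
  nlinarith

end Perturbation

end FactorReg

/-! ### Calculus of expectations and elementary inequalities -/

namespace FactorReg

open scoped Matrix.Norms.Frobenius

section ExpLe

variable {Ω : Type*} [MeasurableSpace Ω] {μ : Measure Ω} {Z Z' : Ω → ℝ} {a b : ℝ}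

namespace ExpLe

lemma add (h : ExpLe μ Z a) (h' : ExpLe μ Z' b) : ExpLe μ (fun ω => Z ω + Z' ω) (a + b) :=
  ⟨h.1.add h'.1, by rw [integral_add h.1 h'.1]; exact add_le_add h.2 h'.2⟩

lemma const_mul (h : ExpLe μ Z a) {c : ℝ} (hc : 0 ≤ c) : ExpLe μ (fun ω => c * Z ω) (c * a) :=
  ⟨h.1.const_mul c, by rw [integral_const_mul]; exact mul_le_mul_of_nonneg_left h.2 hc⟩

lemma mono_right (h : ExpLe μ Z a) (hab : a ≤ b) : ExpLe μ Z b := ⟨h.1, h.2.trans hab⟩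

lemma const [IsProbabilityMeasure μ] (c : ℝ) : ExpLe μ (fun _ => c) c :=
  ⟨integrable_const c, by simp⟩

lemma sum {ι : Type*} {s : Finset ι} {Z : ι → Ω → ℝ} {a : ι → ℝ}
    (h : ∀ i ∈ s, ExpLe μ (Z i) (a i)) : ExpLe μ (fun ω => ∑ i ∈ s, Z i ω) (∑ i ∈ s, a i) :=
  ⟨integrable_finsetSum s fun i hi => (h i hi).1, by
    rw [integral_finsetSum s fun i hi => (h i hi).1]
    exact Finset.sum_le_sum fun i hi => (h i hi).2⟩

lemma mono_left (h : ExpLe μ Z a) (hm : Measurable Z') (h0 : ∀ ω, 0 ≤ Z' ω)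
    (hle : ∀ ω, Z' ω ≤ Z ω) : ExpLe μ Z' a := by
  have hi : Integrable Z' μ := h.1.mono' hm.aestronglyMeasurable
    (ae_of_all _ fun ω => by rw [Real.norm_of_nonneg (h0 ω)]; exact hle ω)
  exact ⟨hi, (integral_mono hi h.1 hle).trans h.2⟩

end ExpLe

lemma integrable_mul_of_sq {f g : Ω → ℝ} (hf : Measurable f) (hg : Measurable g)
    (hf2 : Integrable (fun ω => f ω ^ 2) μ) (hg2 : Integrable (fun ω => g ω ^ 2) μ) :
    Integrable (fun ω => f ω * g ω) μ := by
  refine (hf2.add hg2).mono' (hf.mul hg).aestronglyMeasurable (ae_of_all _ fun ω => ?_)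
  rw [Real.norm_eq_abs, abs_le]
  simp only [Pi.add_apply]
  constructor <;> nlinarith [sq_nonneg (f ω + g ω), sq_nonneg (f ω - g ω)]

end ExpLe

section Elementary

variable {ι κ : Type*} [Fintype ι] [Fintype κ]

lemma vecNorm_sq (v : ι → ℝ) : vecNorm v ^ 2 = ∑ i, v i ^ 2 := by
  rw [vecNorm, EuclideanSpace.real_norm_sq_eq]

lemma vecNorm_nonneg (v : ι → ℝ) : 0 ≤ vecNorm v := norm_nonneg _

/-- The weighted Cauchy-Schwarz inequality. -/
lemma sq_sum_mul_le {b : ι → ℝ} {M : ℝ} (hb : ∑ i, |b i| ≤ M) (x : ι → ℝ) :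
    (∑ i, b i * x i) ^ 2 ≤ M * ∑ i, |b i| * x i ^ 2 := by
  have h := Finset.sum_sq_le_sum_mul_sum_of_sq_le_mul Finset.univ (r := fun i => b i * x i)
    (f := fun i => |b i|) (g := fun i => |b i| * x i ^ 2) (fun i _ => abs_nonneg _)
    (fun i _ => by positivity)
    (fun i _ => le_of_eq (by rw [← mul_assoc, abs_mul_abs_self]; ring))
  exact h.trans (mul_le_mul_of_nonneg_right hb (Finset.sum_nonneg fun i _ => by positivity))

lemma card_mul_inv_mul_sum {α : Type*} (s : Finset α) (g : α → ℝ) :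
    (s.card : ℝ) * ((s.card : ℝ)⁻¹ * ∑ j ∈ s, g j) = ∑ j ∈ s, g j := by
  rcases s.eq_empty_or_nonempty with rfl | hs
  · simp
  · rw [← mul_assoc, mul_inv_cancel₀ (by exact_mod_cast hs.card_pos.ne'), one_mul]

lemma frobenius_norm_sq_le_of_rows {A : Matrix ι κ ℝ} {K : ℝ} (hA : ∀ i, vecNorm (A i) ≤ K) :
    ‖A‖ ^ 2 ≤ Fintype.card ι * K ^ 2 := by
  rw [frobenius_norm_sq, ← nsmul_eq_mul, ← Finset.card_univ, ← Finset.sum_const]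
  refine Finset.sum_le_sum fun i _ => ?_
  rw [← vecNorm_sq]
  exact pow_le_pow_left₀ (vecNorm_nonneg _) (hA i) 2

lemma abs_mul_transpose_le_of_rows {ν : Type*} {A : Matrix ν κ ℝ} {K : ℝ} (hA : ∀ i, vecNorm (A i) ≤ K)
    (i j : ν) : |(A * Aᵀ) i j| ≤ K ^ 2 := by
  have h1 : (A * Aᵀ) i j = inner ℝ (WithLp.toLp 2 (A i)) (WithLp.toLp 2 (A j)) := by
    simp [mul_apply, PiLp.inner_apply, mul_comm]
  rw [h1, sq]
  exact (abs_real_inner_le_norm _ _).trans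
    (mul_le_mul (hA i) (hA j) (norm_nonneg _) ((norm_nonneg _).trans (hA i)))

/-- Used for `e * Λ`: after taking expectations each term is controlled by the cross-sectional
covariance bound `τ i j`. -/
lemma norm_mul_sq_eq_sum (A : Matrix ι κ ℝ) {ν : Type*} [Fintype ν] (B : Matrix κ ν ℝ) :
    ‖A * B‖ ^ 2 = ∑ t, ∑ i, ∑ j, (B * Bᵀ) i j * (A t i * A t j) := by
  rw [← frobenius_norm_transpose, frobenius_norm_sq_eq_trace, transpose_transpose, transpose_mul,
    Matrix.mul_assoc, ← Matrix.mul_assoc B]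
  simp only [trace, diag_apply, Matrix.mul_apply (M := A), Matrix.mul_apply (M := B * Bᵀ),
    transpose_apply, Finset.mul_sum]
  exact Finset.sum_congr rfl fun t _ => Finset.sum_congr rfl fun i _ =>
    Finset.sum_congr rfl fun j _ => by ring

lemma norm_cols_sq {n p : ℕ} (A : Matrix (Fin n) (Fin p) ℝ) (J : Finset (Fin p)) :
    ‖cols A J‖ ^ 2 = ∑ t, ∑ j ∈ J, A t j ^ 2 := by
  rw [frobenius_norm_sq]
  refine Finset.sum_congr rfl fun t _ => ?_
  rw [← Finset.sum_coe_sort J fun j => A t j ^ 2]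
  rfl

end Elementary

/-! ### Moment bounds in the factor model -/

namespace Model

variable {Ω : Type*} {S : Model Ω} {M : ℝ}

lemma AssumptionA.M_nonneg (hA : S.AssumptionA M) : 0 ≤ M :=
  (Finset.sum_nonneg fun _ _ => abs_nonneg _).trans (hA.A3 0)

/-- The coefficients outside of the selection set. -/
def βC (S : Model Ω) (n : ℕ) : Fin (S.p n) → ℝ := fun i => if i ∈ S.J n then 0 else S.β n i

/-- The noise in the regression on the selected predictors and the factors. -/
def noise (S : Model Ω) (n : ℕ) (ω : Ω) : Fin n → ℝ := S.e n ω *ᵥ S.βC n + S.ε n ω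

lemma sum_abs_βC_le (hA : S.AssumptionA M) (n : ℕ) : ∑ i, |S.βC n i| ≤ M := by
  refine (Finset.sum_le_sum fun i _ => ?_).trans (hA.A3 n)
  unfold βC
  split_ifs <;> simp

/-- The unselected predictors act through the factors, with coefficient `Λᵀ β_C`, and through their
idiosyncratic parts, which join the error. -/
lemma Y_eq (S : Model Ω) (n : ℕ) (ω : Ω) :
    S.Y n ω = cols (S.X n ω) (S.J n) *ᵥ S.βJ n +
      (S.F n ω *ᵥ ((S.Λ n)ᵀ *ᵥ S.βC n) + S.noise n ω) := by
  have h1 : S.X n ω *ᵥ S.β n = cols (S.X n ω) (S.J n) *ᵥ S.βJ n + S.X n ω *ᵥ S.βC n := by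
    ext t
    simp only [mulVec, dotProduct, Pi.add_apply, cols, submatrix_apply, id, βJ, βC]
    rw [Finset.sum_coe_sort (S.J n) (fun j => S.X n ω t j * S.β n j)]
    have : ∑ j ∈ S.J n, S.X n ω t j * S.β n j =
        ∑ j, if j ∈ S.J n then S.X n ω t j * S.β n j else 0 := by
      rw [Finset.sum_ite_mem, Finset.univ_inter]
    rw [this, ← Finset.sum_add_distrib]
    refine Finset.sum_congr rfl fun j _ => ?_
    split_ifs <;> simp
  rw [Y, h1, noise]
  conv_lhs => rw [show S.X n ω *ᵥ S.βC n = (S.F n ω * (S.Λ n)ᵀ + S.e n ω) *ᵥ S.βC n from rfl]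
  rw [add_mulVec, mulVec_mulVec]
  abel

lemma vecNorm_loadings_mulVec_le (hA : S.AssumptionA M) {K : ℝ}
    (hK : ∀ n i, vecNorm (S.Λ n i) ≤ K) (hK0 : 0 ≤ K) (n : ℕ) :
    vecNorm ((S.Λ n)ᵀ *ᵥ S.βC n) ≤ M * K := by
  have hM := hA.M_nonneg
  have hb := sum_abs_βC_le hA n
  refine le_of_sq_le_sq ?_ (by positivity)
  rw [vecNorm_sq]
  calc ∑ a, ((S.Λ n)ᵀ *ᵥ S.βC n) a ^ 2 ≤ ∑ a, M * ∑ i, |S.βC n i| * S.Λ n i a ^ 2 := by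
        refine Finset.sum_le_sum fun a _ => ?_
        have h : ((S.Λ n)ᵀ *ᵥ S.βC n) a = ∑ i, S.βC n i * S.Λ n i a := by
          rw [Matrix.mulVec, dotProduct]
          exact Finset.sum_congr rfl fun i _ => mul_comm _ _
        rw [h]
        exact sq_sum_mul_le hb fun i => S.Λ n i a
    _ = M * ∑ i, |S.βC n i| * vecNorm (S.Λ n i) ^ 2 := by
        rw [← Finset.mul_sum, Finset.sum_comm]
        exact congrArg _ (Finset.sum_congr rfl fun i _ => by rw [vecNorm_sq, Finset.mul_sum])
    _ ≤ M * ∑ i, |S.βC n i| * K ^ 2 := by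
        gcongr with i
        exacts [vecNorm_nonneg _, hK n i]
    _ ≤ (M * K) ^ 2 := by
        rw [← Finset.sum_mul, mul_pow, sq M, mul_assoc]
        gcongr

variable [MeasurableSpace Ω] {μ : Measure Ω}

lemma expLe_sum_sq_of_normalized {n : ℕ} (hn : 0 < n) {σ : Type*} {J : Finset σ}
    {Z : σ → Fin n → Ω → ℝ}
    (h : ExpLe μ (fun ω => (J.card : ℝ)⁻¹ * ∑ j ∈ J, ((Real.sqrt n)⁻¹ * ∑ t, Z j t ω) ^ 2) M) :
    ExpLe μ (fun ω => ∑ j ∈ J, (∑ t, Z j t ω) ^ 2) (M * (J.card * n)) := by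
  have hn' : (0 : ℝ) < n := by exact_mod_cast hn
  have h' := h.const_mul (by positivity : (0 : ℝ) ≤ n * J.card)
  refine ExpLe.mono_right (a := n * J.card * M) ?_ (le_of_eq (by ring))
  convert h' using 1
  ext ω
  rw [mul_assoc, card_mul_inv_mul_sum, Finset.mul_sum]
  refine Finset.sum_congr rfl fun j _ => ?_
  rw [mul_pow, inv_pow, Real.sq_sqrt hn'.le, ← mul_assoc, mul_inv_cancel₀ hn'.ne', one_mul]

lemma expLe_norm_factors_mul_cols_sq (hC : S.AssumptionC μ M) (n : ℕ) (hn : 0 < n) :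
    ExpLe μ (fun ω => ‖(S.F n ω)ᵀ * cols (S.e n ω) (S.J n)‖ ^ 2) (M * (S.m n * n)) := by
  have hn' : (0 : ℝ) < n := by exact_mod_cast hn
  have h := (hC.C2 n).const_mul (by positivity : (0 : ℝ) ≤ n * S.m n)
  refine ExpLe.mono_right (a := n * S.m n * M) ?_ (le_of_eq (by ring))
  convert h using 1
  ext ω
  rw [mul_assoc, m, card_mul_inv_mul_sum, Finset.mul_sum, frobenius_norm_sq, Finset.sum_comm,
    ← Finset.sum_coe_sort (S.J n)]
  refine Finset.sum_congr rfl fun j _ => ?_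
  rw [vecNorm_sq, Finset.mul_sum]
  refine Finset.sum_congr rfl fun a _ => ?_
  have h1 : ((Real.sqrt n)⁻¹ • ∑ t, S.e n ω t j • S.F n ω t) a =
      (Real.sqrt n)⁻¹ * ∑ t, S.F n ω t a * S.e n ω t j := by
    simp [Finset.sum_apply, mul_comm]
  rw [h1, mul_pow, inv_pow, Real.sq_sqrt hn'.le, ← mul_assoc, mul_inv_cancel₀ hn'.ne', one_mul]
  simp [mul_apply, cols]

variable [IsProbabilityMeasure μ]

lemma expLe_e_sq (hS : S.Regular μ) (hB : S.AssumptionB μ M) (n t i) :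
    ExpLe μ (fun ω => S.e n ω t i ^ 2) (1 + M) := by
  refine ((ExpLe.const 1).add (hB.B3_moment n t i)).mono_left ((hS.meas_e n t i).pow_const 2)
    (fun ω => sq_nonneg _) fun ω => ?_
  rw [← sq_abs]
  rcases le_total |S.e n ω t i| 1 with h | h
  · have := pow_le_one₀ (n := 2) (abs_nonneg (S.e n ω t i)) h
    have := pow_nonneg (abs_nonneg (S.e n ω t i)) 8
    linarith
  · have := pow_le_pow_right₀ h (by norm_num : 2 ≤ 8)
    linarith

lemma integrable_e_mul_e (hS : S.Regular μ) (hB : S.AssumptionB μ M) (n s t i j) :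
    Integrable (fun ω => S.e n ω s i * S.e n ω t j) μ :=
  integrable_mul_of_sq (hS.meas_e n s i) (hS.meas_e n t j) (expLe_e_sq hS hB n s i).1
    (expLe_e_sq hS hB n t j).1

lemma expLe_norm_e_mul_loadings_sq (hS : S.Regular μ) (hB : S.AssumptionB μ M) {K : ℝ}
    (hK : ∀ n i, vecNorm (S.Λ n i) ≤ K) (n : ℕ) (hp : 0 < S.p n) :
    ExpLe μ (fun ω => ‖S.e n ω * S.Λ n‖ ^ 2) (n * (S.p n * (K ^ 2 * M))) := by
  obtain ⟨τ, hτ, hτM⟩ := hB.B3_cross n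
  have hp' : (0 : ℝ) < S.p n := by exact_mod_cast hp
  rw [inv_mul_le_iff₀ hp'] at hτM
  have h1 : ∀ t i j, ExpLe μ
      (fun ω => (S.Λ n * (S.Λ n)ᵀ) i j * (S.e n ω t i * S.e n ω t j)) (K ^ 2 * |τ i j|) := by
    intro t i j
    refine ⟨(integrable_e_mul_e hS hB n t t i j).const_mul _, ?_⟩
    rw [integral_const_mul]
    refine (le_abs_self _).trans ?_
    rw [abs_mul]
    exact mul_le_mul (abs_mul_transpose_le_of_rows (hK n) i j) (hτ i j t) (abs_nonneg _)
      (sq_nonneg K)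
  have h2 : ExpLe μ (fun ω => ‖S.e n ω * S.Λ n‖ ^ 2) (∑ _t : Fin n, ∑ i, ∑ j, K ^ 2 * |τ i j|) := by
    simp only [norm_mul_sq_eq_sum]
    exact ExpLe.sum fun t _ => ExpLe.sum fun i _ => ExpLe.sum fun j _ => h1 t i j
  refine h2.mono_right ?_
  rw [Finset.sum_const, Finset.card_univ, Fintype.card_fin, nsmul_eq_mul]
  simp only [← Finset.mul_sum]
  have h3 := mul_le_mul_of_nonneg_left hτM (sq_nonneg K)
  refine mul_le_mul_of_nonneg_left ?_ n.cast_nonneg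
  linarith

/-- Each entry of `e eᵀ` is its mean `p γ(s,t)` plus a fluctuation of order `√p`. The squared means
sum to `O(p² n)`, because `γ² ≤ M |γ|` and `γ` is absolutely summable; the fluctuations contribute
`O(p n²)`. -/
lemma exists_expLe_norm_e_mul_transpose_sq (hS : S.Regular μ) (hA : S.AssumptionA M)
    (hB : S.AssumptionB μ M) (n : ℕ) (hn : 0 < n) (hp : 0 < S.p n) :
    ∃ R : Ω → ℝ, (∀ ω, ‖S.e n ω * (S.e n ω)ᵀ‖ ^ 2 ≤ R ω) ∧
      ExpLe μ R (n * (n * (2 * S.p n * (1 + M))) + 2 * S.p n ^ 2 * (n * M ^ 2)) := by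
  have hM := hA.M_nonneg
  have hp' : (0 : ℝ) < S.p n := by exact_mod_cast hp
  have hn' : (0 : ℝ) < n := by exact_mod_cast hn
  set p : ℝ := (S.p n : ℝ) with hpdef
  set g : Fin n → Fin n → ℝ := fun s t => ∫ ω, p⁻¹ * ∑ i, S.e n ω s i * S.e n ω t i ∂μ with hg
  have hint : ∀ s t, Integrable (fun ω => p⁻¹ * ∑ i, S.e n ω s i * S.e n ω t i) μ := fun s t =>
    (integrable_finsetSum _ fun i _ => integrable_e_mul_e hS hB n s t i i).const_mul _
  -- Only the diagonal is assumed bounded pointwise; `2|xy| ≤ x² + y²` carries this to all `s, t`.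
  have hgM : ∀ s t, |g s t| ≤ M := by
    intro s t
    have hss := (le_abs_self _).trans (hB.B3_serial_diag n s)
    have htt := (le_abs_self _).trans (hB.B3_serial_diag n t)
    have h1 : |g s t| ≤ ∫ ω, ((p⁻¹ * ∑ i, S.e n ω s i * S.e n ω s i) +
        (p⁻¹ * ∑ i, S.e n ω t i * S.e n ω t i)) / 2 ∂μ := by
      rw [hg]
      refine abs_integral_le_integral_abs.trans
        (integral_mono (hint s t).abs (((hint s s).add (hint t t)).div_const 2) fun ω => ?_)
      simp only
      rw [← mul_add, ← Finset.sum_add_distrib, mul_div_assoc, Finset.sum_div, abs_mul,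
        abs_of_pos (inv_pos.2 hp')]
      gcongr
      refine (Finset.abs_sum_le_sum_abs _ _).trans (Finset.sum_le_sum fun i _ => ?_)
      rw [abs_le]
      constructor <;> nlinarith [sq_nonneg (S.e n ω s i + S.e n ω t i),
        sq_nonneg (S.e n ω s i - S.e n ω t i)]
    rw [integral_div, integral_add (hint s s) (hint t t)] at h1
    linarith
  set Z : Fin n → Fin n → Ω → ℝ := fun s t ω => (Real.sqrt (S.p n))⁻¹ *
      ∑ i, (S.e n ω s i * S.e n ω t i - ∫ ω', S.e n ω' s i * S.e n ω' t i ∂μ) with hZ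
  have hdec : ∀ s t ω, (S.e n ω * (S.e n ω)ᵀ) s t = Real.sqrt p * Z s t ω + p * g s t := by
    intro s t ω
    have h1 : p * g s t = ∑ i, ∫ ω', S.e n ω' s i * S.e n ω' t i ∂μ := by
      simp only [hg]
      rw [integral_const_mul, ← mul_assoc, mul_inv_cancel₀ hp'.ne', one_mul,
        integral_finsetSum _ fun i _ => integrable_e_mul_e hS hB n s t i i]
    have h2 : Real.sqrt p * Z s t ω =
        ∑ i, (S.e n ω s i * S.e n ω t i - ∫ ω', S.e n ω' s i * S.e n ω' t i ∂μ) := by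
      simp only [hZ]
      rw [← mul_assoc, mul_inv_cancel₀ (Real.sqrt_pos.2 hp').ne', one_mul]
    rw [h1, h2, ← Finset.sum_add_distrib]
    simp [mul_apply]
  refine ⟨fun ω => ∑ s, ∑ t, (2 * p * (1 + |Z s t ω| ^ 4) + 2 * p ^ 2 * g s t ^ 2),
    fun ω => ?_, ?_⟩
  · rw [frobenius_norm_sq]
    refine Finset.sum_le_sum fun s _ => Finset.sum_le_sum fun t _ => ?_
    rw [hdec]
    have h1 := Real.sq_sqrt hp'.le
    have h2 : (Real.sqrt p * Z s t ω) ^ 2 = p * |Z s t ω| ^ 2 := by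
      rw [mul_pow, h1, sq_abs]
    have h3 : |Z s t ω| ^ 2 ≤ 1 + |Z s t ω| ^ 4 := by nlinarith [sq_nonneg (|Z s t ω| ^ 2 - 1)]
    have h4 := mul_le_mul_of_nonneg_left h3 hp'.le
    nlinarith [sq_nonneg (Real.sqrt p * Z s t ω - p * g s t)]
  · have h1 : ∀ s t, ExpLe μ (fun ω => 2 * p * (1 + |Z s t ω| ^ 4) + 2 * p ^ 2 * g s t ^ 2)
        (2 * p * (1 + M) + 2 * p ^ 2 * (M * |g s t|)) := fun s t => by
      refine ((((ExpLe.const 1).add (hB.B3_fourth n s t)).const_mul (by positivity)).add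
        (ExpLe.const _)).mono_right ?_
      gcongr
      rw [← sq_abs, sq]
      exact mul_le_mul_of_nonneg_right (hgM s t) (abs_nonneg _)
    refine (ExpLe.sum fun s _ => ExpLe.sum fun t _ => h1 s t).mono_right ?_
    have h2 := hB.B3_serial n
    rw [inv_mul_le_iff₀ hn'] at h2
    simp only [Finset.sum_add_distrib, Finset.sum_const, Finset.card_univ, Fintype.card_fin,
      nsmul_eq_mul, ← Finset.mul_sum]
    have h3 := mul_le_mul_of_nonneg_left h2 hM
    refine add_le_add_right (mul_le_mul_of_nonneg_left ?_ (by positivity)) _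
    rw [sq, mul_left_comm]
    exact h3

lemma expLe_norm_cols_e_sq (hS : S.Regular μ) (hB : S.AssumptionB μ M) (n : ℕ) :
    ExpLe μ (fun ω => ‖cols (S.e n ω) (S.J n)‖ ^ 2) ((1 + M) * (S.m n * n)) := by
  simp only [norm_cols_sq]
  refine (ExpLe.sum fun t _ => ExpLe.sum fun j _ => expLe_e_sq hS hB n t j).mono_right
    (le_of_eq ?_)
  simp [m]; ring

lemma exists_expLe_noise_sq (hS : S.Regular μ) (hA : S.AssumptionA M) (hB : S.AssumptionB μ M)
    {K : ℝ} (hK : ∀ n t, ExpLe μ (fun ω => S.ε n ω t ^ 2) K) (n : ℕ) :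
    ∃ R : Ω → ℝ, (∀ ω, vecNorm (S.noise n ω) ^ 2 ≤ R ω) ∧
      ExpLe μ R ((2 * (M * (M * (1 + M))) + 2 * K) * n) := by
  have hM := hA.M_nonneg
  have hb := sum_abs_βC_le hA n
  refine ⟨fun ω => ∑ t, (2 * (M * ∑ i, |S.βC n i| * S.e n ω t i ^ 2) + 2 * S.ε n ω t ^ 2),
    fun ω => ?_, ?_⟩
  · rw [vecNorm_sq]
    refine Finset.sum_le_sum fun t _ => ?_
    have h1 := sq_sum_mul_le hb (fun i => S.e n ω t i)
    have h2 : S.noise n ω t = (∑ i, S.βC n i * S.e n ω t i) + S.ε n ω t := by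
      simp [noise, mulVec, dotProduct, mul_comm]
    rw [h2]
    nlinarith [sq_nonneg ((∑ i, S.βC n i * S.e n ω t i) - S.ε n ω t)]
  · have h1 : ∀ t, ExpLe μ
        (fun ω => 2 * (M * ∑ i, |S.βC n i| * S.e n ω t i ^ 2) + 2 * S.ε n ω t ^ 2)
        (2 * (M * (M * (1 + M))) + 2 * K) := fun t => by
      refine ((((ExpLe.sum fun i _ => (expLe_e_sq hS hB n t i).const_mul
        (abs_nonneg (S.βC n i))).mono_right ?_).const_mul hM).const_mul two_pos.le).add
        ((hK n t).const_mul two_pos.le)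
      rw [← Finset.sum_mul]
      gcongr
    refine (ExpLe.sum fun t _ => h1 t).mono_right (le_of_eq ?_)
    rw [Finset.sum_const, Finset.card_univ, Fintype.card_fin, nsmul_eq_mul, mul_comm]

lemma exists_expLe_cols_transpose_mulVec_noise_sq (hA : S.AssumptionA M)
    (hC : S.AssumptionC μ M) (n : ℕ) (hn : 0 < n) :
    ∃ R : Ω → ℝ, (∀ ω, vecNorm ((cols (S.e n ω) (S.J n))ᵀ *ᵥ S.noise n ω) ^ 2 ≤ R ω) ∧
      ExpLe μ R ((2 * (M * (M * M)) + 2 * M) * (S.m n * n)) := by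
  have hM := hA.M_nonneg
  have hb := sum_abs_βC_le hA n
  refine ⟨fun ω => 2 * (M * ∑ i, |S.βC n i| *
      ∑ j ∈ S.J n, (∑ t, S.e n ω t i * S.e n ω t j) ^ 2) +
      2 * ∑ j ∈ S.J n, (∑ t, S.ε n ω t * S.e n ω t j) ^ 2, fun ω => ?_, ?_⟩
  · have h1 : ∀ j ∈ S.J n, (∑ t, S.e n ω t j * S.noise n ω t) ^ 2 ≤
        2 * (M * ∑ i, |S.βC n i| * (∑ t, S.e n ω t i * S.e n ω t j) ^ 2) +
        2 * (∑ t, S.ε n ω t * S.e n ω t j) ^ 2 := by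
      intro j _
      have h2 : ∑ t, S.e n ω t j * S.noise n ω t =
          (∑ i, S.βC n i * ∑ t, S.e n ω t i * S.e n ω t j) + ∑ t, S.ε n ω t * S.e n ω t j := by
        simp only [Finset.mul_sum]
        rw [Finset.sum_comm, ← Finset.sum_add_distrib]
        refine Finset.sum_congr rfl fun t _ => ?_
        simp only [noise, Pi.add_apply, mulVec, dotProduct, mul_add, Finset.mul_sum]
        congr 1
        · exact Finset.sum_congr rfl fun i _ => by ring
        · ring
      rw [h2]
      have h3 := sq_sum_mul_le hb (fun i => ∑ t, S.e n ω t i * S.e n ω t j)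
      nlinarith [sq_nonneg ((∑ i, S.βC n i * ∑ t, S.e n ω t i * S.e n ω t j) -
        ∑ t, S.ε n ω t * S.e n ω t j)]
    have h4 : vecNorm ((cols (S.e n ω) (S.J n))ᵀ *ᵥ S.noise n ω) ^ 2 =
        ∑ j ∈ S.J n, (∑ t, S.e n ω t j * S.noise n ω t) ^ 2 := by
      rw [vecNorm_sq,
        ← Finset.sum_coe_sort (S.J n) fun j => (∑ t, S.e n ω t j * S.noise n ω t) ^ 2]
      rfl
    rw [h4]
    refine (Finset.sum_le_sum h1).trans (le_of_eq ?_)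
    rw [Finset.sum_add_distrib, ← Finset.mul_sum, ← Finset.mul_sum, ← Finset.mul_sum,
      Finset.sum_comm]
    simp only [Finset.mul_sum]
  · have h1 : ∀ i, ExpLe μ (fun ω => |S.βC n i| *
        ∑ j ∈ S.J n, (∑ t, S.e n ω t i * S.e n ω t j) ^ 2)
        (|S.βC n i| * (M * (S.m n * n))) := by
      intro i
      -- The covariance bound is available only outside the selection set; inside it the weight `βC`
      -- vanishes.
      by_cases hi : i ∈ S.J n
      · have : S.βC n i = 0 := by simp [βC, hi]
        simpa [this] using ExpLe.const (μ := μ) 0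
      · exact (expLe_sum_sq_of_normalized hn (hC.C4 n i hi)).const_mul (abs_nonneg _)
    refine ((((ExpLe.sum fun i _ => h1 i).const_mul hM).const_mul two_pos.le).add
      ((expLe_sum_sq_of_normalized hn (hC.C3 n)).const_mul two_pos.le)).mono_right ?_
    rw [← Finset.sum_mul, ← m]
    have h2 : (∑ i, |S.βC n i|) * (M * (S.m n * n)) ≤ M * (M * (S.m n * n)) := by gcongr
    nlinarith [mul_le_mul_of_nonneg_left h2 hM]

end Model

end FactorReg

/-! ### Asymptotics and the theorem -/

namespace FactorReg

open scoped Matrix.Norms.Frobenius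

namespace Model

section Asymptotics

variable {Ω : Type*} {S : Model Ω} {M : ℝ}

lemma AssumptionA.eventually_le (hA : S.AssumptionA M) :
    ∃ K : ℝ, 0 < K ∧ ∀ᶠ n : ℕ in atTop, (n : ℝ) ≤ K * S.p n := by
  obtain ⟨K, hK0, hK⟩ := hA.A2_p.exists_pos
  refine ⟨K, hK0, hK.bound.mono fun n hn => ?_⟩
  simpa using hn

lemma AssumptionA.tendsto_sqrt_p (hA : S.AssumptionA M) :
    Tendsto (fun n => Real.sqrt (S.p n)) atTop atTop := by
  obtain ⟨K, hK0, hK⟩ := hA.eventually_le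
  refine Real.tendsto_sqrt_atTop.comp ?_
  refine tendsto_atTop_mono' atTop (hK.mono fun n hn => ?_)
    (tendsto_natCast_atTop_atTop.atTop_div_const hK0)
  rw [div_le_iff₀ hK0]; linarith

/-- The size `m` is a natural number, so `m ≤ m²`. -/
lemma AssumptionA.tendsto_sqrt_m_div (hA : S.AssumptionA M) :
    Tendsto (fun n : ℕ => Real.sqrt ((S.m n : ℝ) / n)) atTop (𝓝 0) := by
  have h : Tendsto (fun n : ℕ => (S.m n : ℝ) / n) atTop (𝓝 0) := by
    refine squeeze_zero (fun n => by positivity) (fun n => ?_) hA.A2_m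
    gcongr
    exact_mod_cast Nat.le_self_pow two_ne_zero (S.m n)
  simpa using h.sqrt

variable [MeasurableSpace Ω] {μ : Measure Ω}

lemma AssumptionB.eventually_gram_loadings (hA : S.AssumptionA M) (hB : S.AssumptionB μ M) :
    ∀ᶠ C : ℝ in atTop, ∀ᶠ n in atTop, IsUnit ((S.Λ n)ᵀ * S.Λ n).det ∧
      ‖((S.Λ n)ᵀ * S.Λ n)⁻¹‖ ≤ C / Real.sqrt (S.p n) ^ 2 ∧
      ‖S.Λ n‖ ≤ C * Real.sqrt (S.p n) := by
  obtain ⟨G, hG, hlim⟩ := hB.B2_limit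
  obtain ⟨δ, hδ, C₀, hC₀⟩ := exists_forall_gram_bounds (isUnit_iff_ne_zero.2 hG.det_pos.ne')
  filter_upwards [eventually_ge_atTop C₀] with C hC
  filter_upwards [hlim.eventually (eventually_lt_nhds hδ),
    hA.tendsto_sqrt_p.eventually (eventually_gt_atTop 0)] with n hn hp
  rw [frobNorm_eq] at hn
  have hp' : 0 < S.p n := by exact_mod_cast Real.sqrt_pos.1 hp
  obtain ⟨h1, h2, h3⟩ := hC₀ _ hp' _ hn
  rw [Real.sq_sqrt (Nat.cast_nonneg _)]
  exact ⟨h1, h2.trans (by gcongr), h3.trans (by gcongr)⟩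

lemma AssumptionB.holdsInProb_gram_factors (hB : S.AssumptionB μ M) :
    HoldsInProb μ fun C n ω => IsUnit ((S.F n ω)ᵀ * S.F n ω).det ∧
      ‖((S.F n ω)ᵀ * S.F n ω)⁻¹‖ ≤ C / Real.sqrt n ^ 2 ∧ ‖S.F n ω‖ ≤ C * Real.sqrt n := by
  obtain ⟨G, hG, hlim⟩ := hB.B1_limit
  obtain ⟨δ, hδ, C₀, hC₀⟩ := exists_forall_gram_bounds (isUnit_iff_ne_zero.2 hG.det_pos.ne')
  refine holdsInProb_of_tendstoInMeasure hlim hδ ?_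
  filter_upwards [eventually_ge_atTop C₀] with C hC
  filter_upwards [eventually_gt_atTop 0] with n hn ω hω
  rw [frobNorm_eq] at hω
  obtain ⟨h1, h2, h3⟩ := hC₀ _ hn _ hω
  rw [Real.sq_sqrt (Nat.cast_nonneg _)]
  exact ⟨h1, h2.trans (by gcongr), h3.trans (by gcongr)⟩

lemma AssumptionC.exists_holdsInProb_coercive (hC : S.AssumptionC μ M) :
    ∃ κ : ℝ, 0 < κ ∧ HoldsInProb μ fun _ n ω => ∀ a : Matrix (S.J n) Unit ℝ,
      κ * Real.sqrt n * ‖a‖ ≤ ‖cols (S.e n ω) (S.J n) * a‖ := by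
  obtain ⟨G, ⟨c, hc, hG⟩, hlim⟩ := hC.C1
  refine ⟨Real.sqrt (c / 2), Real.sqrt_pos.2 (half_pos hc),
    holdsInProb_of_tendstoInMeasure hlim (half_pos hc) (Eventually.of_forall fun C => ?_)⟩
  filter_upwards [eventually_gt_atTop 0] with n hn ω hω
  rw [frobNorm_eq] at hω
  exact norm_mul_ge_of_gram hn hc (hG n) hω

variable [IsProbabilityMeasure μ]

lemma holdsInProb_norm_e_mul_transpose (hS : S.Regular μ) (hA : S.AssumptionA M)
    (hB : S.AssumptionB μ M) : HoldsInProb μ fun C n ω =>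
      ‖S.e n ω * (S.e n ω)ᵀ‖ ≤ C * (Real.sqrt (S.p n) ^ 2 * Real.sqrt n) := by
  obtain ⟨K, hK0, hK⟩ := hA.eventually_le
  have hM := hA.M_nonneg
  refine holdsInProb_of_expLe_sq (B := 2 * K * (1 + M) + 2 * M ^ 2)
    (fun n => by positivity) ?_
  filter_upwards [hK, eventually_gt_atTop 0, hA.tendsto_sqrt_p.eventually (eventually_gt_atTop 0)]
    with n hn hn0 hp
  obtain ⟨R, hR, hR'⟩ := exists_expLe_norm_e_mul_transpose_sq hS hA hB n hn0
    (by exact_mod_cast Real.sqrt_pos.1 hp)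
  refine ⟨R, hR, hR'.mono_right ?_⟩
  rw [Real.sq_sqrt (Nat.cast_nonneg _), mul_pow, Real.sq_sqrt (Nat.cast_nonneg _)]
  -- `n = O(p)` brings the fluctuation term `n² p` down to the order `n p²` of the means.
  have h : (n : ℝ) * (n * (2 * S.p n * (1 + M))) ≤
      n * (K * S.p n * (2 * S.p n * (1 + M))) := by gcongr
  linarith

/-- The rate of convergence of the estimator with the true number of factors. -/
lemma isBigOp_estError (hS : S.Regular μ) (hA : S.AssumptionA M) (hB : S.AssumptionB μ M)
    (hC : S.AssumptionC μ M) {W : ∀ n, Ω → Matrix (Fin (S.p n)) (Fin (S.p n)) ℝ}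
    (hW : ∀ n ω, IsSortedEigenbasis ((S.X n ω)ᵀ * S.X n ω) (W n ω)) :
    IsBigOp μ (fun n ω => S.estError W S.r n ω) fun n => Real.sqrt ((S.m n : ℝ) / n) := by
  have hM := hA.M_nonneg
  obtain ⟨K, hK0, hnp⟩ := hA.eventually_le
  obtain ⟨L, hL⟩ := hB.B2_bound
  obtain ⟨V, hV⟩ := hS.var_ε
  obtain ⟨κ, hκ, hG⟩ := hC.exists_holdsInProb_coercive
  have hp0 : ∀ᶠ n in atTop, 0 < S.p n :=
    (hA.tendsto_sqrt_p.eventually (eventually_gt_atTop 0)).mono fun n hn => by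
      exact_mod_cast Real.sqrt_pos.1 hn
  have heL : HoldsInProb μ fun C n ω =>
      ‖S.e n ω * S.Λ n‖ ≤ C * (Real.sqrt n * Real.sqrt (S.p n)) := by
    refine holdsInProb_of_expLe_sq (B := L ^ 2 * M) (fun n => by positivity) ?_
    filter_upwards [hp0] with n hn
    refine ⟨_, fun ω => le_rfl, (expLe_norm_e_mul_loadings_sq hS hB hL n hn).mono_right
      (le_of_eq ?_)⟩
    rw [mul_pow, Real.sq_sqrt (Nat.cast_nonneg _), Real.sq_sqrt (Nat.cast_nonneg _)]; ring
  have heJ : HoldsInProb μ fun C n ω =>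
      ‖cols (S.e n ω) (S.J n)‖ ≤ C * (Real.sqrt (S.m n) * Real.sqrt n) := by
    refine holdsInProb_of_expLe_sq (B := 1 + M) (fun n => by positivity)
      (Eventually.of_forall fun n => ⟨_, fun ω => le_rfl, ?_⟩)
    rw [mul_pow, Real.sq_sqrt (Nat.cast_nonneg _), Real.sq_sqrt (Nat.cast_nonneg _)]
    exact expLe_norm_cols_e_sq hS hB n
  have hFe : HoldsInProb μ fun C n ω => ‖(S.F n ω)ᵀ * cols (S.e n ω) (S.J n)‖ ≤
      C * (Real.sqrt (S.m n) * Real.sqrt n) := by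
    refine holdsInProb_of_expLe_sq (B := M) (fun n => by positivity) ?_
    filter_upwards [eventually_gt_atTop 0] with n hn
    refine ⟨_, fun ω => le_rfl, ?_⟩
    rw [mul_pow, Real.sq_sqrt (Nat.cast_nonneg _), Real.sq_sqrt (Nat.cast_nonneg _)]
    exact expLe_norm_factors_mul_cols_sq hC n hn
  have hw : HoldsInProb μ fun C n ω => vecNorm (S.noise n ω) ≤ C * Real.sqrt n := by
    refine holdsInProb_of_expLe_sq (B := 2 * (M * (M * (1 + M))) + 2 * V)
      (fun n => by positivity) (Eventually.of_forall fun n => ?_)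
    rw [Real.sq_sqrt (Nat.cast_nonneg _)]
    exact exists_expLe_noise_sq hS hA hB hV n
  have hew : HoldsInProb μ fun C n ω =>
      vecNorm ((cols (S.e n ω) (S.J n))ᵀ *ᵥ S.noise n ω) ≤
        C * (Real.sqrt (S.m n) * Real.sqrt n) := by
    refine holdsInProb_of_expLe_sq (B := 2 * (M * (M * M)) + 2 * M) (fun n => by positivity) ?_
    filter_upwards [eventually_gt_atTop 0] with n hn
    rw [mul_pow, Real.sq_sqrt (Nat.cast_nonneg _), Real.sq_sqrt (Nat.cast_nonneg _)]
    exact exists_expLe_cols_transpose_mulVec_noise_sq hA hC n hn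
  let A : ℝ → ℝ := fun C => C ^ 3 + 8 * C ^ 11 * S.r * C
  refine HoldsInProb.isBigOp
    (g := fun C => 4 * (A C * C * (A C * C + C) + A C * C ^ 2 + C + A C * C) / κ ^ 2)
    (fun n ω => vecNorm_nonneg _) ?_
  refine (hB.holdsInProb_gram_factors.and <| heL.and <|
    (holdsInProb_norm_e_mul_transpose hS hA hB).and <| heJ.and <| hFe.and <| hw.and <|
    hew.and hG).mono ?_
  -- The nonrandom bounds fix how large `C` must be; with `C` fixed, `n` is then taken large enough
  -- for the thresholds `2 C⁴ ≤ √p` and the smallness of `√(m/n)`, which depend on `C`.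
  filter_upwards [hB.eventually_gram_loadings hA, eventually_ge_atTop 1,
    eventually_ge_atTop (Real.sqrt K), eventually_ge_atTop |L|, eventually_ge_atTop (M * |L|)]
    with C hgL hC1 hCK hCL hCML
  have hsmall : ∀ᶠ n : ℕ in atTop,
      2 * (A C * C + A C) * Real.sqrt ((S.m n : ℝ) / n) < κ := by
    have h : Tendsto (fun n => 2 * (A C * C + A C) * Real.sqrt ((S.m n : ℝ) / n)) atTop
        (𝓝 0) := by
      simpa using hA.tendsto_sqrt_m_div.const_mul (2 * (A C * C + A C))
    exact h.eventually (eventually_lt_nhds hκ)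
  filter_upwards [hgL, hnp, hp0, eventually_gt_atTop 0, hsmall,
    hA.tendsto_sqrt_p.eventually (eventually_ge_atTop (2 * C ^ 4))]
    with n hgLn hnpn hpn hn hsmalln hQ ω hω
  obtain ⟨⟨hF1, hF2, hF3⟩, heLω, heeω, heJω, hFeω, hwω, hewω, hGω⟩ := hω
  have hC0 : 0 ≤ C := zero_le_one.trans hC1
  have hsn : 0 < Real.sqrt n := Real.sqrt_pos.2 (by exact_mod_cast hn)
  have hL' : ∀ n i, vecNorm (S.Λ n i) ≤ |L| := fun n i => (hL n i).trans (le_abs_self L)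
  have hbounds : FactorBounds (S.F n ω) (S.Λ n) (S.e n ω) C (Real.sqrt n)
      (Real.sqrt (S.p n)) :=
    { one_le_K := hC1
      one_le_N := Real.one_le_sqrt.2 (by exact_mod_cast hn)
      Q_large := hQ
      N_le := by
        refine (Real.sqrt_le_sqrt hnpn).trans ?_
        rw [Real.sqrt_mul hK0.le]
        gcongr
      norm_F := hF3
      gram_F := hF1
      gram_F_inv := hF2
      norm_L := hgLn.2.2
      gram_L := hgLn.1
      gram_L_inv := hgLn.2.1
      norm_eL := heLω
      norm_ee := heeω }
  have hLJ : ‖cols (S.Λ n)ᵀ (S.J n)‖ ≤ C * Real.sqrt (S.m n) := by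
    have h1 : ‖(cols (S.Λ n)ᵀ (S.J n))ᵀ‖ ^ 2 ≤ Fintype.card (S.J n) * |L| ^ 2 :=
      frobenius_norm_sq_le_of_rows fun j => hL' n j
    rw [frobenius_norm_transpose, Fintype.card_coe] at h1
    refine le_of_sq_le_sq (h1.trans ?_) (by positivity)
    rw [mul_pow, Real.sq_sqrt (Nat.cast_nonneg _), mul_comm, m]
    gcongr
  rw [Real.sqrt_div (Nat.cast_nonneg _)] at hsmalln ⊢
  refine hbounds.vecNorm_betaTilde_sub_le (hW n ω) hn hpn (Real.sqrt_nonneg _) hκ rfl hLJ heJω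
    hFeω hGω ?_ ((vecNorm_loadings_mulVec_le hA hL' (abs_nonneg L) n).trans hCML) hwω hewω
    (S.Y_eq n ω)
  rw [← mul_div_assoc, div_lt_iff₀ hsn] at hsmalln
  exact hsmalln.le

end Asymptotics

end Model

end FactorReg

theorem theorem4 {Ω : Type*} [MeasurableSpace Ω] (μ : Measure Ω) [IsProbabilityMeasure μ]
    (S : FactorReg.Model Ω) (M : ℝ) (hS : S.Regular μ)
    (hA : S.AssumptionA M) (hB : S.AssumptionB μ M) (hC : S.AssumptionC μ M)
    (W : ∀ n, Ω → Matrix (Fin (S.p n)) (Fin (S.p n)) ℝ)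
    (hW : ∀ n ω, FactorReg.IsSortedEigenbasis ((S.X n ω)ᵀ * S.X n ω) (W n ω)) :
    -- the rate for the estimator with `r` estimated factors
    FactorReg.IsBigOp μ (fun n ω => S.estError W S.r n ω)
      (fun n => Real.sqrt ((S.m n : ℝ) / n)) ∧
    -- its consistency
    TendstoInMeasure μ (fun n ω => S.estError W S.r n ω) atTop (fun _ => 0) ∧
    -- the rate given that the estimated number of factors is `r`
    (∀ (kmax : ℕ) (khat : ∀ n : ℕ, Ω → ℕ),
      (∀ n ω, FactorReg.IsFactorNumber (S.X n ω) (W n ω) kmax (khat n ω)) →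
      ∀ η : ℝ, 0 < η → ∀ δ : ℝ, 0 < δ → ∃ C : ℝ, ∀ᶠ n in atTop,
        ENNReal.ofReal δ ≤ μ {ω | khat n ω = S.r} →
        μ {ω | khat n ω = S.r ∧
            C * Real.sqrt ((S.m n : ℝ) / n) < S.estError W (khat n ω) n ω} ≤
          ENNReal.ofReal η * μ {ω | khat n ω = S.r}) := by
  have h := FactorReg.Model.isBigOp_estError hS hA hB hC hW
  refine ⟨h, h.tendstoInMeasure hA.tendsto_sqrt_m_div, fun kmax khat _ η hη δ hδ => ?_⟩
  obtain ⟨C, hC⟩ := h.conditional (fun n => {ω | khat n ω = S.r}) hη hδ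
  refine ⟨C, hC.mono fun n hn hD => (measure_mono fun ω hω => ?_).trans (hn hD)⟩
  simp only [Set.mem_ofPred_eq] at hω ⊢
  exact ⟨hω.1, hω.1 ▸ hω.2⟩
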